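/- Let $G$ be a finite abelian group with unit $e$, and let $\alpha=((A_g)_{g\in G},(\alpha_g)_{g\in G})$ be a partial action of $G$ on a separable $C^*$-algebra $A$. That is, the $A_g$ are closed two-sided ideals of $A$ and the $\alpha_g\colon A_{g^{-1}}\to A_g$ are $*$-isomorphisms such that $A_e=A$, $\alpha_e=\mathrm{id}_A$, and $\alpha_{gh}$ extends $\alpha_g\circ\alpha_h$ wherever the latter is defined. Then the dual action $\widehat\alpha$ has the Rokhlin property if and only if $\alpha$ is global and approximately representable. Here the notions are as follows. The partial crossed product $A\rtimes_\alpha G$ is the $*$-algebra of formal sums $\sum_{g\in G}a_gu_g$ with $a_g\in A_g$, with product determined by $(a_gu_g)(b_hu_h)=\alpha_g(\alpha_{g^{-1}}(a_g)b_h)u_{gh}$ and involution determined by $(a_gu_g)^*=\alpha_{g^{-1}}(a_g^*)u_{g^{-1}}$, equipped with its unique complete $C^*$-norm. The dual action of $\widehat G=\mathrm{Hom}(G,\mathbb T)$ on $A\rtimes_\alpha G$ is the global action given by $\widehat\alpha_\chi(a_gu_g)=\chi(g)a_gu_g$. A partial action $\beta=((B_g)_{g\in H},(\beta_g)_{g\in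 H})$ of a finite group $H$ on a $C^*$-algebra $B$ is global if $B_g=B$ for all $g\in H$. It has the Rokhlin property if for every $\varepsilon>0$ and every finite subset $F\subseteq B$ there are positive contractions $f_g\in B_g$, $g\in H$, such that 1. $\|f_gf_ha\|<\varepsilon$ for all $g\neq h$ in $H$ and $a\in F$; 2. $\|(f_gb-bf_g)a\|<\varepsilon$ for all $g\in H$ and $a,b\in F$; 3. $\|(\sum_{g\in H}f_g)a-a\|<\varepsilon$ for all $a\in F$; 4. $\|(\beta_g(f_hx)-f_{gh}\beta_g(x))a\|<\varepsilon$ for all $g,h\in H$, $a\in F$ and $x\in B_{g^{-1}}\cap F$. It is approximately representable if for every $\varepsilon>0$ and every finite subset $F\subseteq B$ there are contractions $x_g\in B_{g^{-1}}$, $g\in H$, with $x_e\geq 0$, such that 1. $\|(x_g^*x_g-x_gx_g^*)b\|<\varepsilon$ for all $g\in H$ and $b\in F$; 2. $\|(x_gx_h-x_ex_{gh})b\|<\varepsilon$ for all $g,h\in H$ and $b\in F$; 3. $\|(\beta_g(ax_h)-\beta_g(a)x_{ghg^{-1}})b\|<\varepsilon$ for all $g,h\in H$, $a\in B_{g^{-1}}\cap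 F$ and $b\in F$; 4. $\|x_eb-b\|<\varepsilon$ for all $b\in F$; 5. $\|x_gb-\beta_g(b)x_g\|<\varepsilon$ for all $g\in H$ and $b\in B_{g^{-1}}\cap F$. -/

import Mathlib

/-- A partial action of a group `G` on a C⋆-algebra `A`: closed two-sided ideals `A_g` of `A` and
`*`-isomorphisms `α_g : A_{g⁻¹} → A_g` such that `α_1 = id_A` and `α_{gh}` extends `α_g ∘ α_h`.
(Closed two-sided ideals of a C⋆-algebra are automatically `*`-invariant, so it is no restriction
to record them as `*`-subalgebras.) -/
structure PartialAction (G A : Type*) [Group G] [NonUnitalCStarAlgebra A] where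
  /-- the ideals `A_g` -/
  ideal : G → NonUnitalStarSubalgebra ℂ A
  isClosed_ideal : ∀ g, IsClosed (ideal g : Set A)
  mul_mem_left : ∀ (g : G) (a : A) {x : A}, x ∈ ideal g → a * x ∈ ideal g
  mul_mem_right : ∀ (g : G) (a : A) {x : A}, x ∈ ideal g → x * a ∈ ideal g
  /-- the isomorphisms `α_g : A_{g⁻¹} → A_g` -/
  map : ∀ g, ideal g⁻¹ ≃⋆ₐ[ℂ] ideal g
  ideal_one : ideal 1 = ⊤
  map_one : ∀ x : ideal 1⁻¹, (map 1 x : A) = x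
  map_map : ∀ (g h : G) (x : ideal h⁻¹) (hx : (map h x : A) ∈ ideal g⁻¹),
    ∃ hx' : (x : A) ∈ ideal (g * h)⁻¹, (map (g * h) ⟨x, hx'⟩ : A) = map g ⟨map h x, hx⟩

namespace PartialAction

section Basic

variable {G A : Type*} [Group G] [NonUnitalCStarAlgebra A] (α : PartialAction G A)

/-- A partial action is global if `A_g = A` for all `g`. -/
def IsGlobal : Prop := ∀ g, α.ideal g = ⊤

open Classical in
/-- The map `α_g`, as a function on `A` with value `0` outside of its domain `A_{g⁻¹}`. -/
noncomputable def act (g : G) (a : A) : A :=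
  if h : a ∈ α.ideal g⁻¹ then (α.map g ⟨a, h⟩ : A) else 0

lemma act_of_mem (g : G) {a : A} (h : a ∈ α.ideal g⁻¹) : α.act g a = α.map g ⟨a, h⟩ :=
  dif_pos h

lemma act_mem (g : G) (a : A) : α.act g a ∈ α.ideal g := by
  unfold act
  split_ifs with h
  · exact (α.map g ⟨a, h⟩).2
  · exact zero_mem _

lemma act_mem_inv (g : G) (a : A) : α.act g⁻¹ a ∈ α.ideal g⁻¹ := α.act_mem _ _

lemma act_mul (g : G) {a b : A} (ha : a ∈ α.ideal g⁻¹) (hb : b ∈ α.ideal g⁻¹) :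
    α.act g (a * b) = α.act g a * α.act g b := by
  rw [α.act_of_mem g ha, α.act_of_mem g hb, α.act_of_mem g (mul_mem ha hb)]
  exact congrArg Subtype.val (map_mul (α.map g) ⟨a, ha⟩ ⟨b, hb⟩)

lemma act_add (g : G) {a b : A} (ha : a ∈ α.ideal g⁻¹) (hb : b ∈ α.ideal g⁻¹) :
    α.act g (a + b) = α.act g a + α.act g b := by
  rw [α.act_of_mem g ha, α.act_of_mem g hb, α.act_of_mem g (add_mem ha hb)]
  exact congrArg Subtype.val (map_add (α.map g) ⟨a, ha⟩ ⟨b, hb⟩)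

lemma act_smul (g : G) (c : ℂ) {a : A} (ha : a ∈ α.ideal g⁻¹) :
    α.act g (c • a) = c • α.act g a := by
  rw [α.act_of_mem g ha, α.act_of_mem g (SMulMemClass.smul_mem c ha)]
  exact congrArg Subtype.val (map_smul (α.map g) c ⟨a, ha⟩)

lemma act_star (g : G) {a : A} (ha : a ∈ α.ideal g⁻¹) :
    α.act g (star a) = star (α.act g a) := by
  rw [α.act_of_mem g ha, α.act_of_mem g (star_mem ha)]
  exact congrArg Subtype.val (map_star (α.map g) ⟨a, ha⟩)

lemma act_zero (g : G) : α.act g 0 = 0 := by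
  simpa using α.act_smul g 0 (zero_mem (α.ideal g⁻¹))

lemma act_sum (g : G) {ι : Type*} (s : Finset ι) (f : ι → A) (hf : ∀ i, f i ∈ α.ideal g⁻¹) :
    α.act g (∑ i ∈ s, f i) = ∑ i ∈ s, α.act g (f i) := by
  classical
  induction s using Finset.induction_on with
  | empty => simp [act_zero]
  | insert i s hi ih =>
    rw [Finset.sum_insert hi, Finset.sum_insert hi, α.act_add g (hf i) (sum_mem fun j _ ↦ hf j), ih]

lemma mem_ideal_one (a : A) : a ∈ α.ideal 1 := by
  rw [α.ideal_one]; trivial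

lemma act_one (a : A) : α.act 1 a = a := by
  have h : a ∈ α.ideal 1⁻¹ := by rw [inv_one]; exact α.mem_ideal_one a
  rw [α.act_of_mem 1 h, α.map_one]

lemma act_act (g h : G) {a : A} (ha : a ∈ α.ideal h⁻¹) (ha' : α.act h a ∈ α.ideal g⁻¹) :
    a ∈ α.ideal (g * h)⁻¹ ∧ α.act (g * h) a = α.act g (α.act h a) := by
  rw [α.act_of_mem g ha']
  simp only [α.act_of_mem h ha] at ha' ⊢
  obtain ⟨h1, h2⟩ := α.map_map g h ⟨a, ha⟩ ha'
  exact ⟨h1, (α.act_of_mem _ h1).trans h2⟩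

lemma act_inv_act (g : G) {a : A} (ha : a ∈ α.ideal g⁻¹) : α.act g⁻¹ (α.act g a) = a := by
  have h := (α.act_act g⁻¹ g ha (by rw [inv_inv]; exact α.act_mem g a)).2
  rw [← h, inv_mul_cancel, act_one]

lemma act_act_inv (g : G) {a : A} (ha : a ∈ α.ideal g) : α.act g (α.act g⁻¹ a) = a := by
  have h := α.act_inv_act g⁻¹ (a := a) (by rwa [inv_inv])
  rwa [inv_inv] at h

lemma act_mem_mul (g h : G) {a : A} (ha : a ∈ α.ideal g⁻¹) (ha' : a ∈ α.ideal h) :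
    α.act g a ∈ α.ideal (g * h) := by
  have h1 : α.act g⁻¹ (α.act g a) ∈ α.ideal h⁻¹⁻¹ := by
    rw [α.act_inv_act g ha, inv_inv]; exact ha'
  have h2 := (α.act_act h⁻¹ g⁻¹ (a := α.act g a) (by rw [inv_inv]; exact α.act_mem g a) h1).1
  rwa [← mul_inv_rev, inv_inv] at h2

lemma norm_act (g : G) {a : A} (ha : a ∈ α.ideal g⁻¹) : ‖α.act g a‖ = ‖a‖ := by
  rw [α.act_of_mem g ha]
  have : IsClosed (α.ideal g : Set A) := α.isClosed_ideal g
  have : IsClosed (α.ideal g⁻¹ : Set A) := α.isClosed_ideal g⁻¹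
  exact NonUnitalStarAlgHom.norm_map (α.map g) (α.map g).injective ⟨a, ha⟩

/-- The coefficient `α_g(α_{g⁻¹}(a) b)` of the product `(a u_g)(b u_h)`. -/
noncomputable def conv (g : G) (a b : A) : A := α.act g (α.act g⁻¹ a * b)

lemma conv_mem_left (g : G) (a b : A) : α.conv g a b ∈ α.ideal g := α.act_mem g _

lemma conv_mem (g h : G) (a : A) {b : A} (hb : b ∈ α.ideal h) :
    α.conv g a b ∈ α.ideal (g * h) :=
  α.act_mem_mul g h (α.mul_mem_right _ _ (α.act_mem_inv g a)) (α.mul_mem_left _ _ hb)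

lemma conv_add_right (g : G) (a b c : A) :
    α.conv g a (b + c) = α.conv g a b + α.conv g a c := by
  unfold conv
  rw [mul_add, α.act_add g] <;> exact α.mul_mem_right _ _ (α.act_mem_inv g a)

lemma conv_add_left (g : G) {a b : A} (c : A) (ha : a ∈ α.ideal g) (hb : b ∈ α.ideal g) :
    α.conv g (a + b) c = α.conv g a c + α.conv g b c := by
  unfold conv
  rw [α.act_add g⁻¹ (by rwa [inv_inv]) (by rwa [inv_inv]), add_mul, α.act_add g] <;>
  exact α.mul_mem_right _ _ (α.act_mem_inv g _)

lemma conv_smul_right (g : G) (z : ℂ) (a b : A) : α.conv g a (z • b) = z • α.conv g a b := by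
  unfold conv
  rw [mul_smul_comm, α.act_smul g]
  exact α.mul_mem_right _ _ (α.act_mem_inv g a)

lemma conv_smul_left (g : G) (z : ℂ) {a : A} (b : A) (ha : a ∈ α.ideal g) :
    α.conv g (z • a) b = z • α.conv g a b := by
  unfold conv
  rw [α.act_smul g⁻¹ z (by rwa [inv_inv]), smul_mul_assoc, α.act_smul g]
  exact α.mul_mem_right _ _ (α.act_mem_inv g a)

lemma conv_zero_right (g : G) (a : A) : α.conv g a 0 = 0 := by
  simp [conv, act_zero]

lemma conv_zero_left (g : G) (b : A) : α.conv g 0 b = 0 := by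
  simp [conv, act_zero]

lemma conv_sum_right (g : G) (a : A) {ι : Type*} (s : Finset ι) (f : ι → A) :
    α.conv g a (∑ i ∈ s, f i) = ∑ i ∈ s, α.conv g a (f i) := by
  unfold conv
  rw [Finset.mul_sum, α.act_sum g]
  exact fun i ↦ α.mul_mem_right _ _ (α.act_mem_inv g a)

lemma conv_sum_left (g : G) (b : A) {ι : Type*} (s : Finset ι) (f : ι → A)
    (hf : ∀ i, f i ∈ α.ideal g) :
    α.conv g (∑ i ∈ s, f i) b = ∑ i ∈ s, α.conv g (f i) b := by
  unfold conv
  rw [α.act_sum g⁻¹ _ _ (fun i ↦ by rw [inv_inv]; exact hf i), Finset.sum_mul, α.act_sum g]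
  exact fun i ↦ α.mul_mem_right _ _ (α.act_mem_inv g _)

lemma norm_conv_le (g : G) {a : A} (ha : a ∈ α.ideal g) (b : A) :
    ‖α.conv g a b‖ ≤ ‖a‖ * ‖b‖ := by
  unfold conv
  rw [α.norm_act g (α.mul_mem_right _ _ (α.act_mem_inv g a))]
  refine (norm_mul_le _ _).trans ?_
  rw [α.norm_act g⁻¹ (by rwa [inv_inv])]

lemma conv_one (a b : A) : α.conv 1 a b = a * b := by
  simp [conv, act_one]

/-- `(ca) u_g b = c (a u_g b)`, for `c` in the ideal. -/
lemma conv_mul_of_mem (g : G) {a c : A} (b : A) (ha : a ∈ α.ideal g) (hc : c ∈ α.ideal g) :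
    α.conv g (c * a) b = c * α.conv g a b := by
  unfold conv
  rw [α.act_mul g⁻¹ (by rwa [inv_inv]) (by rwa [inv_inv]), mul_assoc,
    α.act_mul g (α.act_mem_inv g c) (α.mul_mem_right _ _ (α.act_mem_inv g a)), α.act_act_inv g hc]

/-- `(ca) u_g b = c (a u_g b)`, for arbitrary `c`. -/
lemma conv_mul (g : G) {a : A} (b c : A) (ha : a ∈ α.ideal g) :
    α.conv g (c * a) b = c * α.conv g a b := by
  have key : ∀ d ∈ α.ideal g, d * (α.conv g (c * a) b - c * α.conv g a b) = 0 := by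
    intro d hd
    rw [mul_sub, ← mul_assoc, ← α.conv_mul_of_mem g b (α.mul_mem_left g c ha) hd,
      ← α.conv_mul_of_mem g b ha (α.mul_mem_right g c hd), mul_assoc, sub_self]
  have hz : α.conv g (c * a) b - c * α.conv g a b ∈ α.ideal g :=
    sub_mem (α.conv_mem_left _ _ _) (α.mul_mem_left _ _ (α.conv_mem_left _ _ _))
  exact sub_eq_zero.1 (CStarRing.star_mul_self_eq_zero_iff _ |>.1 (key _ (star_mem hz)))

lemma conv_act (g : G) {a : A} (b : A) (ha : a ∈ α.ideal g⁻¹) :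
    α.conv g (α.act g a) b = α.act g (a * b) := by
  rw [conv, α.act_inv_act g ha]

lemma conv_assoc (g h : G) {a b : A} (c : A) (hb : b ∈ α.ideal h) :
    α.conv (g * h) (α.conv g a b) c = α.conv g a (α.conv h b c) := by
  set p := α.act g⁻¹ a with hp
  have hpm : p ∈ α.ideal g⁻¹ := α.act_mem_inv g a
  have h1 : p * b ∈ α.ideal g⁻¹ := α.mul_mem_right _ _ hpm
  have h2 : p * b ∈ α.ideal h := α.mul_mem_left _ _ hb
  have h3 : α.act (g * h)⁻¹ (α.conv g a b) = α.act h⁻¹ (p * b) := by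
    have := (α.act_act (g * h)⁻¹ g h1
      (by rw [inv_inv]; exact α.act_mem_mul g h h1 h2)).2
    rw [conv, ← hp, ← this]
    congr 1
    group
  have h4 : α.act h (α.act h⁻¹ (p * b) * c) = p * α.conv h b c := by
    rw [← α.conv_mul h c p hb, conv]
  have h5 : α.act h⁻¹ (p * b) * c ∈ α.ideal h⁻¹ := α.mul_mem_right _ _ (α.act_mem_inv h _)
  rw [conv, h3, (α.act_act g h h5 (by rw [h4]; exact α.mul_mem_right _ _ hpm)).2, h4]
  rfl

end Basic

section CrossedProduct

variable {G A : Type*} [Group G] [NonUnitalCStarAlgebra A] (α : PartialAction G A)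

/-- The partial crossed product `A ⋊_α G` of a finite group: the family `x = (x_g)_g`, `x_g ∈ A_g`,
stands for the formal linear combination `∑ g, x_g u_g`. -/
def CrossedProduct : Type _ := (g : G) → α.ideal g

namespace CrossedProduct

noncomputable instance : AddCommGroup α.CrossedProduct :=
  inferInstanceAs (AddCommGroup ((g : G) → α.ideal g))

noncomputable instance : Module ℂ α.CrossedProduct :=
  inferInstanceAs (Module ℂ ((g : G) → α.ideal g))

variable {α}

@[ext]
lemma ext {x y : α.CrossedProduct} (h : ∀ g, (x g : A) = y g) : x = y :=
  funext fun g ↦ Subtype.ext (h g)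

@[simp] lemma add_apply (x y : α.CrossedProduct) (g : G) : ((x + y) g : A) = x g + y g := rfl
@[simp] lemma zero_apply (g : G) : ((0 : α.CrossedProduct) g : A) = 0 := rfl
@[simp] lemma smul_apply (c : ℂ) (x : α.CrossedProduct) (g : G) :
    ((c • x) g : A) = c • (x g : A) := rfl

lemma conv_mem_apply (x y : α.CrossedProduct) (g k : G) :
    α.conv g (x g) (y (g⁻¹ * k)) ∈ α.ideal k := by
  simpa using α.conv_mem g (g⁻¹ * k) (x g : A) (y (g⁻¹ * k)).2

lemma coeff_congr (x : α.CrossedProduct) {g h : G} (e : g = h) : (x g : A) = x h := by rw [e]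

lemma star_coeff_mem (x : α.CrossedProduct) (g : G) : star (x g : A) ∈ α.ideal g :=
  star_mem (x g).2

/-- The convolution product, determined by
`(a_g u_g)(b_h u_h) = α_g(α_{g⁻¹}(a_g) b_h) u_{gh}`. -/
noncomputable instance [Fintype G] : Mul α.CrossedProduct where
  mul x y k := ⟨∑ g, α.conv g (x g) (y (g⁻¹ * k)), sum_mem fun g _ ↦ conv_mem_apply x y g k⟩

/-- The involution, determined by `(a_g u_g)⋆ = α_{g⁻¹}(a_g⋆) u_{g⁻¹}`. -/
noncomputable instance : Star α.CrossedProduct where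
  star x g := ⟨α.act g (star (x g⁻¹ : A)), α.act_mem g _⟩

lemma star_apply (x : α.CrossedProduct) (g : G) :
    (star x g : A) = α.act g (star (x g⁻¹ : A)) := rfl

/-- The element `a u_g` of the crossed product. -/
noncomputable def single [DecidableEq G] (g : G) (a : α.ideal g) : α.CrossedProduct :=
  Pi.single g a

lemma single_same [DecidableEq G] (g : G) (a : α.ideal g) : (single g a g : A) = a := by
  simp [single]

lemma single_ne [DecidableEq G] {g h : G} (e : h ≠ g) (a : α.ideal g) :
    (single g a h : A) = 0 := by
  simp [single, Pi.single_eq_of_ne e]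

lemma star_single [DecidableEq G] (g : G) (a : α.ideal g) :
    star (single g a) = single g⁻¹ ⟨α.act g⁻¹ (star (a : A)), α.act_mem g⁻¹ _⟩ := by
  ext k
  rw [star_apply]
  by_cases e : k = g⁻¹
  · subst e
    rw [(single g a).coeff_congr (inv_inv g), single_same, single_same]
  · rw [single_ne e, single_ne (fun e' ↦ e (by rw [← e', inv_inv])), star_zero, act_zero]

variable [Fintype G]

lemma mul_apply (x y : α.CrossedProduct) (k : G) :
    ((x * y) k : A) = ∑ g, α.conv g (x g) (y (g⁻¹ * k)) := rfl

noncomputable instance : NonUnitalRing α.CrossedProduct where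
  left_distrib x y z := by
    ext k
    simp only [mul_apply, add_apply, conv_add_right, Finset.sum_add_distrib]
  right_distrib x y z := by
    ext k
    simp only [mul_apply, add_apply, ← Finset.sum_add_distrib]
    exact Finset.sum_congr rfl fun g _ ↦ α.conv_add_left g _ (x g).2 (y g).2
  zero_mul x := by ext k; simp [mul_apply, conv_zero_left]
  mul_zero x := by ext k; simp [mul_apply, conv_zero_right]
  mul_assoc x y z := by
    ext k
    simp only [mul_apply]
    have h1 : ∀ l, α.conv l (∑ g, α.conv g (x g) (y (g⁻¹ * l))) (z (l⁻¹ * k)) =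
        ∑ g, α.conv l (α.conv g (x g) (y (g⁻¹ * l))) (z (l⁻¹ * k)) := fun l ↦
      α.conv_sum_left l _ _ _ fun g ↦ conv_mem_apply x y g l
    simp only [h1, conv_sum_right]
    rw [Finset.sum_comm]
    refine Finset.sum_congr rfl fun g _ ↦ ?_
    rw [← Equiv.sum_comp (Equiv.mulLeft g)]
    refine Finset.sum_congr rfl fun h _ ↦ ?_
    rw [Equiv.coe_mulLeft, y.coeff_congr (inv_mul_cancel_left g h),
      z.coeff_congr (show (g * h)⁻¹ * k = h⁻¹ * (g⁻¹ * k) by group)]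
    exact α.conv_assoc g h _ (y h).2

instance : IsScalarTower ℂ α.CrossedProduct α.CrossedProduct where
  smul_assoc c x y := by
    ext k
    simp only [smul_eq_mul, mul_apply, smul_apply, Finset.smul_sum]
    exact Finset.sum_congr rfl fun g _ ↦ α.conv_smul_left g c _ (x g).2

instance : SMulCommClass ℂ α.CrossedProduct α.CrossedProduct where
  smul_comm c x y := by
    ext k
    simp only [smul_eq_mul, mul_apply, smul_apply, Finset.smul_sum, conv_smul_right]

noncomputable instance : StarRing α.CrossedProduct where
  star_involutive x := by
    ext g
    rw [star_apply, star_apply, ← α.act_star _ (x.star_coeff_mem _), star_star, inv_inv]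
    · exact α.act_act_inv g (x g).2
  star_add x y := by
    ext g
    simp only [star_apply, add_apply, star_add]
    exact α.act_add g (x.star_coeff_mem _) (y.star_coeff_mem _)
  star_mul x y := by
    ext k
    simp only [star_apply, mul_apply, star_sum]
    rw [α.act_sum k]
    swap
    · exact fun g ↦ star_mem (conv_mem_apply x y g k⁻¹)
    refine Eq.trans ?_ (Equiv.sum_comp (Equiv.mulLeft k) _)
    refine Finset.sum_congr rfl fun g _ ↦ ?_
    have e1 : (y (k * g)⁻¹ : A) = y (g⁻¹ * k⁻¹) := y.coeff_congr (mul_inv_rev k g)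
    have e2 : (x ((k * g)⁻¹ * k)⁻¹ : A) = x g := x.coeff_congr (by group)
    have e3 : (k * g)⁻¹ * k = g⁻¹ := by group
    have hy : star (y (g⁻¹ * k⁻¹) : A) ∈ α.ideal (g⁻¹ * k⁻¹) := y.star_coeff_mem _
    have hx : star (x g : A) ∈ α.ideal g⁻¹⁻¹ := by rw [inv_inv]; exact x.star_coeff_mem g
    have hp := α.act_mem_inv g (x g : A)
    have hz1 : star (y (g⁻¹ * k⁻¹) : A) * star (α.act g⁻¹ (x g)) ∈ α.ideal g⁻¹ :=
      α.mul_mem_left _ _ (star_mem hp)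
    have hz2 : star (y (g⁻¹ * k⁻¹) : A) * star (α.act g⁻¹ (x g)) ∈ α.ideal (g⁻¹ * k⁻¹) :=
      α.mul_mem_right _ _ hy
    have hz3 := α.act_mem_mul g _ hz1 hz2
    rw [mul_inv_cancel_left] at hz3
    rw [Equiv.coe_mulLeft, e1, e2, e3, α.conv_act (k * g) _ (by rwa [mul_inv_rev]),
      α.act_star g⁻¹ (by rw [inv_inv]; exact (x g).2), (α.act_act k g hz1 hz3).2, conv,
      ← α.act_star g (α.mul_mem_right _ _ hp), star_mul]

instance : StarModule ℂ α.CrossedProduct where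
  star_smul c x := by
    ext g
    simp only [star_apply, smul_apply, star_smul]
    exact α.act_smul g _ (x.star_coeff_mem _)

lemma sum_single [DecidableEq G] (x : α.CrossedProduct) : ∑ g, single g (x g) = x :=
  Finset.univ_sum_single x

lemma single_mul_single [DecidableEq G] (g h : G) (a : α.ideal g) (b : α.ideal h) :
    single g a * single h b = single (g * h) ⟨α.conv g a b, α.conv_mem g h a b.2⟩ := by
  ext k
  rw [mul_apply, Finset.sum_eq_single g]
  · rw [single_same]
    by_cases e : k = g * h
    · subst e
      rw [(single h b).coeff_congr (inv_mul_cancel_left g h), single_same, single_same]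
    · rw [single_ne e, single_ne (fun e' ↦ e (by rw [← e', mul_inv_cancel_left])),
        conv_zero_right]
  · intro l _ hl
    rw [single_ne hl, conv_zero_left]
  · simp

lemma mul_star_apply_one (x y : α.CrossedProduct) :
    ((x * star y) 1 : A) = ∑ g, (x g : A) * star (y g : A) := by
  rw [mul_apply]
  refine Finset.sum_congr rfl fun g _ ↦ ?_
  rw [(star y).coeff_congr (mul_one g⁻¹), star_apply, y.coeff_congr (inv_inv g), conv,
    ← α.act_mul g⁻¹, α.act_act_inv]
  · exact α.mul_mem_right _ _ (x g).2
  · rw [inv_inv]; exact (x g).2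
  · rw [inv_inv]; exact y.star_coeff_mem g

end CrossedProduct

/-- The crossed product as the Hilbert `A`-module `⨁ g, A_g` with `⟨x, y⟩ = ∑ g, y_g x_g⋆`. -/
def RegularModule : Type _ := α.CrossedProduct

namespace RegularModule

attribute [local instance] CStarAlgebra.spectralOrder CStarAlgebra.spectralOrderedRing

open scoped WithCStarModule

noncomputable instance : AddCommGroup α.RegularModule :=
  inferInstanceAs (AddCommGroup α.CrossedProduct)

noncomputable instance : Module ℂ α.RegularModule :=
  inferInstanceAs (Module ℂ α.CrossedProduct)

/-- The identity map, from the crossed product to the Hilbert module. -/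
noncomputable def of : α.CrossedProduct ≃ₗ[ℂ] α.RegularModule := LinearEquiv.refl ℂ α.CrossedProduct

/-- The inclusion of `⨁ g, A_g` into the standard Hilbert module `⨁ g, A`. -/
noncomputable def incl : α.RegularModule →ₗ[ℂ] C⋆ᵐᵒᵈ(A, G → A) where
  toFun x := (WithCStarModule.equiv A (G → A)).symm fun g ↦ ((of α).symm x g : A)
  map_add' _ _ := rfl
  map_smul' _ _ := rfl

variable {α}

lemma incl_injective : Function.Injective (incl α) := fun x y h ↦
  CrossedProduct.ext (x := (of α).symm x) (y := (of α).symm y) fun g ↦ congrFun h g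

variable [Fintype G]

noncomputable instance : NormedAddCommGroup α.RegularModule :=
  NormedAddCommGroup.induced _ _ (incl α) incl_injective

noncomputable instance : NormedSpace ℂ α.RegularModule := NormedSpace.induced _ _ _ (incl α)

lemma norm_def (x : α.RegularModule) : ‖x‖ = ‖incl α x‖ := rfl

lemma inner_incl (x y : α.CrossedProduct) :
    inner A (incl α (of α x)) (incl α (of α y)) = ((y * star x) 1 : A) := by
  rw [CrossedProduct.mul_star_apply_one]; rfl

lemma norm_apply_le (x : α.CrossedProduct) (g : G) : ‖(x g : A)‖ ≤ ‖of α x‖ :=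
  WithCStarModule.norm_apply_le_norm (incl α (of α x)) g

lemma norm_le_sum (x : α.CrossedProduct) : ‖of α x‖ ≤ ∑ g, ‖(x g : A)‖ :=
  WithCStarModule.pi_norm_le_sum_norm (incl α (of α x))

lemma norm_sq (x : α.CrossedProduct) : ‖of α x‖ ^ 2 = ‖((x * star x) 1 : A)‖ := by
  rw [norm_def, CStarModule.norm_sq_eq A, inner_incl]

/-- Right multiplication by `b`, as a linear map. -/
noncomputable def mulRightAux (b : α.CrossedProduct) : α.RegularModule →ₗ[ℂ] α.RegularModule where
  toFun y := of α ((of α).symm y * b)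
  map_add' y z := by rw [map_add, add_mul, map_add]
  map_smul' c y := by rw [map_smul, smul_mul_assoc, map_smul, RingHom.id_apply]

lemma mulRightAux_bound (b : α.CrossedProduct) (y : α.RegularModule) :
    ‖mulRightAux b y‖ ≤ (∑ _k : G, ∑ g, ‖(b g : A)‖) * ‖y‖ := by
  obtain ⟨y, rfl⟩ := (of α).surjective y
  refine (norm_le_sum (y * b)).trans ?_
  rw [Finset.sum_mul]
  refine Finset.sum_le_sum fun k _ ↦ ?_
  rw [CrossedProduct.mul_apply]
  refine (norm_sum_le _ _).trans ?_
  rw [← Equiv.sum_comp ((Equiv.inv G).trans (Equiv.mulRight k)) (fun g ↦ ‖(b g : A)‖),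
    Finset.sum_mul]
  refine Finset.sum_le_sum fun g _ ↦ ?_
  refine (α.norm_conv_le g (y g).2 _).trans ?_
  rw [mul_comm]
  exact mul_le_mul_of_nonneg_left (norm_apply_le y g) (norm_nonneg _)

/-- Right multiplication by `b`, as a bounded operator. -/
noncomputable def mulRight : α.CrossedProduct →ₗ[ℂ] (α.RegularModule →L[ℂ] α.RegularModule) where
  toFun b := (mulRightAux b).mkContinuous _ (mulRightAux_bound b)
  map_add' b c := by
    ext1 y; exact congrArg (of α) (mul_add ((of α).symm y) b c)
  map_smul' c b := by
    ext1 y; exact congrArg (of α) (mul_smul_comm c ((of α).symm y) b)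

lemma mulRight_apply (b : α.CrossedProduct) (y : α.CrossedProduct) :
    mulRight b (of α y) = of α (y * b) := rfl

lemma norm_coeff_le (b : α.CrossedProduct) (k : G) : ‖(b k : A)‖ ≤ ‖mulRight b‖ := by
  classical
  rcases (norm_nonneg (b k : A)).eq_or_lt with h | h
  · rw [← h]; exact norm_nonneg _
  let c : α.CrossedProduct := CrossedProduct.single 1 ⟨star (b k : A), α.mem_ideal_one _⟩
  have hc : ∀ g, (c g : A) = if g = 1 then star (b k : A) else 0 := fun g ↦ by
    by_cases e : g = 1
    · subst e; simp [c, CrossedProduct.single_same]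
    · simp [c, CrossedProduct.single_ne e, e]
  have h1 : ‖of α c‖ ≤ ‖(b k : A)‖ := by
    refine (norm_le_sum _).trans (le_of_eq ?_)
    rw [Finset.sum_eq_single 1]
    · rw [hc]; simp
    · intro g _ hg; rw [hc]; simp [hg]
    · simp
  have h2 : ((c * b : α.CrossedProduct) k : A) = star (b k : A) * b k := by
    rw [CrossedProduct.mul_apply, Finset.sum_eq_single 1]
    · rw [hc, α.conv_one, b.coeff_congr (show (1 : G)⁻¹ * k = k by group)]; simp
    · intro g _ hg; rw [hc]; simp [hg, conv_zero_left]
    · simp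
  have h3 := (norm_apply_le (c * b) k).trans ((mulRight b).le_opNorm (of α c))
  rw [h2, CStarRing.norm_star_mul_self] at h3
  exact le_of_mul_le_mul_right (h3.trans (mul_le_mul_of_nonneg_left h1 (norm_nonneg _))) h

lemma mulRight_injective : Function.Injective (mulRight (α := α)) := by
  refine (injective_iff_map_eq_zero _).2 fun b hb ↦ CrossedProduct.ext fun k ↦ ?_
  have := norm_coeff_le b k
  rw [hb, norm_zero] at this
  simpa using this

lemma norm_mulRight_sq_le (b : α.CrossedProduct) :
    ‖mulRight b‖ ^ 2 ≤ ‖mulRight (b * star b)‖ := by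
  have h : ∀ y, ‖mulRight b y‖ ≤ √‖mulRight (b * star b)‖ * ‖y‖ := by
    intro y
    obtain ⟨y, rfl⟩ := (of α).surjective y
    rw [← Real.sqrt_sq (norm_nonneg (of α y)), ← Real.sqrt_mul (norm_nonneg _)]
    refine Real.le_sqrt_of_sq_le ?_
    have : ‖mulRight b (of α y)‖ ^ 2 =
        ‖inner A (incl α (of α y)) (incl α (mulRight (b * star b) (of α y)))‖ := by
      rw [mulRight_apply, mulRight_apply, norm_sq, inner_incl, star_mul, mul_assoc, mul_assoc,
        mul_assoc]
    rw [this]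
    refine (CStarModule.norm_inner_le _).trans ?_
    rw [← norm_def, ← norm_def, sq, ← mul_assoc, mul_comm]
    exact mul_le_mul_of_nonneg_right ((mulRight _).le_opNorm _) (norm_nonneg _)
  have := (mulRight b).opNorm_le_bound (Real.sqrt_nonneg _) h
  calc ‖mulRight b‖ ^ 2 ≤ √‖mulRight (b * star b)‖ ^ 2 := by gcongr
    _ = _ := Real.sq_sqrt (norm_nonneg _)

lemma norm_mulRight_mul_le (b c : α.CrossedProduct) :
    ‖mulRight (b * c)‖ ≤ ‖mulRight b‖ * ‖mulRight c‖ := by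
  have : mulRight (b * c) = (mulRight c).comp (mulRight b) := by
    ext1 y; exact congrArg (of α) (mul_assoc ((of α).symm y) b c).symm
  rw [this, mul_comm]
  exact ContinuousLinearMap.opNorm_comp_le _ _

end RegularModule

namespace CrossedProduct

variable {α} [Fintype G]

/-- The C⋆-norm of the partial crossed product, as the operator norm in the regular representation
on the Hilbert `A`-module `⨁ g, A_g`. With it `A ⋊_α G` is complete and satisfies the C⋆-identity,
see the instance of `NonUnitalCStarAlgebra` below. Since a complete C⋆-norm on a `*`-algebra is
unique, this is also the supremum `sup ‖∑ g, ρ(x_g) π_g‖` over all covariant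
representations `(ρ, π)` of `α` on unital C⋆-algebras, that is, the full and the reduced crossed
product coincide for the finite group `G`. -/
noncomputable instance : NormedAddCommGroup α.CrossedProduct :=
  NormedAddCommGroup.induced _ _ RegularModule.mulRight RegularModule.mulRight_injective

lemma norm_def (x : α.CrossedProduct) : ‖x‖ = ‖RegularModule.mulRight x‖ := rfl

noncomputable instance : NormedSpace ℂ α.CrossedProduct :=
  NormedSpace.induced _ _ _ RegularModule.mulRight

noncomputable instance : NonUnitalNormedRing α.CrossedProduct where
  __ := (inferInstance : NormedAddCommGroup α.CrossedProduct)
  __ := (inferInstance : NonUnitalRing α.CrossedProduct)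
  norm_mul_le b c := RegularModule.norm_mulRight_mul_le b c

lemma norm_le_norm_star (b : α.CrossedProduct) : ‖b‖ ≤ ‖star b‖ := by
  rcases (norm_nonneg b).eq_or_lt with h | h
  · rw [← h]; exact norm_nonneg _
  have h1 : ‖b‖ ^ 2 ≤ ‖b * star b‖ := RegularModule.norm_mulRight_sq_le b
  have h2 := h1.trans (norm_mul_le b (star b))
  rw [sq] at h2
  exact le_of_mul_le_mul_left h2 h

instance : CStarRing α.CrossedProduct where
  norm_mul_self_le b := by
    have h : ‖star b‖ ^ 2 ≤ ‖star b * star (star b)‖ := RegularModule.norm_mulRight_sq_le (star b)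
    rw [star_star] at h
    refine le_trans ?_ h
    rw [sq]
    gcongr <;> exact norm_le_norm_star b

lemma norm_coeff_le (x : α.CrossedProduct) (g : G) : ‖(x g : A)‖ ≤ ‖x‖ :=
  RegularModule.norm_coeff_le x g

lemma norm_le_sum (x : α.CrossedProduct) : ‖x‖ ≤ ∑ _k : G, ∑ g, ‖(x g : A)‖ :=
  ContinuousLinearMap.opNorm_le_bound _ (by positivity) (RegularModule.mulRightAux_bound x)

instance : CompleteSpace α.CrossedProduct := by
  have hc : ∀ g, IsClosed (α.ideal g : Set A) := α.isClosed_ideal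
  have : ∀ g, CompleteSpace (α.ideal g) := fun g ↦ (hc g).completeSpace_coe
  let e₀ : α.CrossedProduct ≃ₗ[ℂ] ((g : G) → α.ideal g) :=
    { toFun := fun x ↦ x
      invFun := fun x ↦ x
      map_add' := fun _ _ ↦ rfl
      map_smul' := fun _ _ ↦ rfl
      left_inv := fun _ ↦ rfl
      right_inv := fun _ ↦ rfl }
  let e : α.CrossedProduct ≃L[ℂ] ((g : G) → α.ideal g) :=
    e₀.toContinuousLinearEquivOfBounds 1 (∑ _k : G, ∑ _g : G, 1)
      (fun x ↦ by
        rw [one_mul]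
        exact (pi_norm_le_iff_of_nonneg (norm_nonneg x)).2 fun g ↦ norm_coeff_le x g)
      (fun x ↦ by
        refine (norm_le_sum _).trans ?_
        simp only [Finset.sum_mul, one_mul]
        exact Finset.sum_le_sum fun k _ ↦ Finset.sum_le_sum fun g _ ↦ norm_le_pi_norm x g)
  exact (completeSpace_congr (e := e.toEquiv) e.isUniformEmbedding).2 inferInstance

noncomputable instance : NonUnitalCStarAlgebra α.CrossedProduct where

end CrossedProduct

end CrossedProduct

section Global

variable {G B : Type*} [Group G] [NonUnitalCStarAlgebra B]

/-- A global action `β : G → Aut(B)`, seen as a partial action with all ideals equal to `B`. -/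
def ofGlobal (β : G →* (B ≃⋆ₐ[ℂ] B)) : PartialAction G B where
  ideal _ := ⊤
  isClosed_ideal _ := isClosed_univ
  mul_mem_left _ _ _ _ := trivial
  mul_mem_right _ _ _ _ := trivial
  map g :=
    { toFun := fun x ↦ ⟨β g x, trivial⟩
      invFun := fun x ↦ ⟨(β g).symm x, trivial⟩
      left_inv := fun x ↦ Subtype.ext ((β g).symm_apply_apply x)
      right_inv := fun x ↦ Subtype.ext ((β g).apply_symm_apply x)
      map_mul' := fun x y ↦ Subtype.ext (map_mul (β g) (x : B) y)
      map_add' := fun x y ↦ Subtype.ext (map_add (β g) (x : B) y)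
      map_star' := fun x ↦ Subtype.ext (map_star (β g) (x : B))
      map_smul' := fun c x ↦ Subtype.ext (map_smul (β g) c (x : B)) }
  ideal_one := rfl
  map_one x := by simp
  map_map g h x _ := ⟨trivial, by simp⟩

lemma ofGlobal_isGlobal (β : G →* (B ≃⋆ₐ[ℂ] B)) : (ofGlobal β).IsGlobal := fun _ ↦ rfl

lemma ofGlobal_act (β : G →* (B ≃⋆ₐ[ℂ] B)) (g : G) (b : B) : (ofGlobal β).act g b = β g b :=
  (ofGlobal β).act_of_mem g (a := b) trivial

end Global

section Dual

variable {G A : Type*} [CommGroup G] [Fintype G] [NonUnitalCStarAlgebra A]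
  (α : PartialAction G A)

/-- The automorphism `a_g u_g ↦ χ(g) a_g u_g` of the crossed product, for a character `χ`. -/
noncomputable def dualAut (χ : G →* Circle) : α.CrossedProduct ≃⋆ₐ[ℂ] α.CrossedProduct where
  toFun x g := (χ g : ℂ) • x g
  invFun x g := (χ⁻¹ g : ℂ) • x g
  left_inv x := by
    funext g
    simp [smul_smul]
  right_inv x := by
    funext g
    simp [smul_smul]
  map_mul' x y := by
    ext k
    change (χ k : ℂ) • ((x * y) k : A) =
      ∑ g, α.conv g ((χ g : ℂ) • (x g : A)) ((χ (g⁻¹ * k) : ℂ) • (y (g⁻¹ * k) : A))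
    rw [CrossedProduct.mul_apply, Finset.smul_sum]
    refine Finset.sum_congr rfl fun g _ ↦ ?_
    rw [α.conv_smul_left g _ _ (x g).2, conv_smul_right, smul_smul, ← Circle.coe_mul, ← map_mul,
      mul_inv_cancel_left]
  map_add' x y := by
    funext g
    exact smul_add _ _ _
  map_star' x := by
    ext g
    change (χ g : ℂ) • α.act g (star (x g⁻¹ : A)) =
      α.act g (star ((χ g⁻¹ : ℂ) • (x g⁻¹ : A)))
    rw [star_smul, α.act_smul g _ (x.star_coeff_mem _), map_inv, Circle.coe_inv_eq_conj]
    simp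
  map_smul' c x := by
    funext g
    exact smul_comm (χ g : ℂ) c (x g)

lemma dualAut_apply (χ : G →* Circle) (x : α.CrossedProduct) (g : G) :
    (α.dualAut χ x g : A) = (χ g : ℂ) • (x g : A) := rfl

/-- The dual action of the dual group `Ĝ = Hom(G, 𝕋)` on the crossed product. -/
noncomputable def dual : PartialAction (G →* Circle) α.CrossedProduct :=
  ofGlobal
    { toFun := α.dualAut
      map_one' := by
        ext x g
        change (((1 : Circle) : ℂ)) • (x g : A) = x g
        simp
      map_mul' := fun χ τ ↦ by
        ext x g
        change ((χ g * τ g : Circle) : ℂ) • (x g : A) = (χ g : ℂ) • (τ g : ℂ) • (x g : A)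
        rw [Circle.coe_mul, mul_smul] }

end Dual

end PartialAction

/-- The dual group of a finite abelian group is finite. -/
noncomputable instance instFintypeDualGroup {G : Type*} [CommGroup G] [Fintype G] :
    Fintype (G →* Circle) :=
  haveI : Finite (G →* Circle) := by
    have : Finite (G →* ℂˣ) := inferInstance
    refine Finite.of_injective (fun χ : G →* Circle ↦ Circle.toUnits.comp χ) fun χ τ h ↦ ?_
    ext g
    exact congrArg Units.val (DFunLike.congr_fun h g)
  Fintype.ofFinite _

/-- Positivity of an element of a C⋆-algebra. -/
def IsPositiveElem {A : Type*} [NonUnitalCStarAlgebra A] (a : A) : Prop := ∃ b : A, a = star b * b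

namespace PartialAction

variable {G A : Type*} [Group G] [Fintype G] [NonUnitalCStarAlgebra A] (α : PartialAction G A)

/-- `α` has Rokhlin dimension at most `d`. -/
def HasRokhlinDimLE (d : ℕ) : Prop :=
  ∀ ε : ℝ, 0 < ε → ∀ F : Finset A, ∃ f : Fin (d + 1) → G → A,
    (∀ j g, f j g ∈ α.ideal g ∧ IsPositiveElem (f j g) ∧ ‖f j g‖ ≤ 1) ∧
    (∀ j, ∀ g h, g ≠ h → ∀ a ∈ F, ‖f j g * f j h * a‖ < ε) ∧
    (∀ j g, ∀ a ∈ F, ∀ b ∈ F, ‖(f j g * b - b * f j g) * a‖ < ε) ∧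
    (∀ a ∈ F, ‖(∑ j, ∑ g, f j g) * a - a‖ < ε) ∧
    (∀ j, ∀ g h, ∀ a ∈ F, ∀ x ∈ F, x ∈ α.ideal g⁻¹ →
      ‖(α.act g (f j h * x) - f j (g * h) * α.act g x) * a‖ < ε)

/-- `α` has the Rokhlin property, that is, its Rokhlin dimension is zero. -/
def HasRokhlinProperty : Prop := α.HasRokhlinDimLE 0

/-- `α` is approximately representable with `d` colors `j = 0, …, d`. -/
def IsApproxRepresentableWith (d : ℕ) : Prop :=
  ∀ ε : ℝ, 0 < ε → ∀ F : Finset A, ∃ x : Fin (d + 1) → G → A,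
    (∀ j g, x j g ∈ α.ideal g⁻¹ ∧ ‖x j g‖ ≤ 1) ∧
    (∀ j, IsPositiveElem (x j 1)) ∧
    (∀ j g, ∀ b ∈ F, ‖(star (x j g) * x j g - x j g * star (x j g)) * b‖ < ε) ∧
    (∀ j g h, ∀ b ∈ F, ‖(x j g * x j h - x j 1 * x j (g * h)) * b‖ < ε) ∧
    (∀ j g h, ∀ a ∈ F, a ∈ α.ideal g⁻¹ → ∀ b ∈ F,
      ‖(α.act g (a * x j h) - α.act g a * x j (g * h * g⁻¹)) * b‖ < ε) ∧
    (∀ b ∈ F, ‖(∑ j, x j 1) * b - b‖ < ε) ∧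
    (∀ j g, ∀ b ∈ F, b ∈ α.ideal g⁻¹ → ‖x j g * b - α.act g b * x j g‖ < ε)

/-- `α` is approximately representable, that is, its representability dimension is zero. -/
def IsApproxRepresentable : Prop := α.IsApproxRepresentableWith 0

end PartialAction

/-! The Rokhlin property of the dual action and the approximate representability of `α` are Fourier
transforms of each other. Both are read in the central sequence algebra of `B = A ⋊_α G`: bounded
nets that asymptotically commute with `B` (`centralNets`), modulo those that annihilate `B` in the
limit (`nullNets`). Nets indexed by a finite set and a tolerance turn the ε-conditions into limits.

In this quotient Rokhlin elements are orthogonal projections `f_χ` with sum `1`, permuted by the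
dual action. Hence `w_g = ∑ χ, χ(g)⁻¹ f_χ` is a unitary representation of `G`, and `w_g` is an
eigenvector of the dual action for the character `τ ↦ τ(g)`. The eigenspace is `A_g u_g`, so `w_g`
lifts to contractions `V_g ∈ A_g u_g` (`exists_isDualRep`). Since `V_g V_{g⁻¹}` is asymptotically a
unit and its coefficient at `1` falls into `A_g`, the ideal `A_g` is all of `A` (`isGlobal`). The
adjoints of the coefficients of `V_g` then approximately represent `α` (`isApproxRep`).

Conversely, for a global action approximately represented by `x_g`, the elements `x_g⋆ u_g` form
such a family `V` (`isDualRep`), and the inverse transform `p_χ = |G|⁻¹ ∑ g, χ(g) V_g` gives Rokhlin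
elements `p_χ⋆ p_χ` (`exists_isDualRokhlin`). -/

open Filter Topology

/-! ### Central nets, null nets and asymptotic units. -/

section Approx

/-- The bounded nets `x` in `B` that asymptotically commute with every element of `B`. -/
def centralNets {ι : Type*} (l : Filter ι) (B : Type*) [NonUnitalCStarAlgebra B] :
    NonUnitalStarSubalgebra ℂ (ι → B) where
  carrier := {x | (∃ C, ∀ i, ‖x i‖ ≤ C) ∧
    ∀ b, Tendsto (fun i ↦ x i * b - b * x i) l (𝓝 0)}
  zero_mem' := ⟨⟨0, by simp⟩, fun b ↦ by simp [tendsto_const_nhds]⟩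
  add_mem' := by
    rintro x y ⟨⟨C, hC⟩, hx⟩ ⟨⟨D, hD⟩, hy⟩
    refine ⟨⟨C + D, fun i ↦ (norm_add_le _ _).trans (add_le_add (hC i) (hD i))⟩, fun b ↦ ?_⟩
    simpa [add_mul, mul_add, add_sub_add_comm] using (hx b).add (hy b)
  smul_mem' := by
    rintro c x ⟨⟨C, hC⟩, hx⟩
    refine ⟨⟨‖c‖ * C, fun i ↦ (norm_smul_le _ _).trans
      (mul_le_mul_of_nonneg_left (hC i) (norm_nonneg c))⟩, fun b ↦ ?_⟩
    simpa [smul_sub, smul_mul_assoc, mul_smul_comm] using (hx b).const_smul c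
  mul_mem' := by
    rintro x y ⟨⟨C, hC⟩, hx⟩ ⟨⟨D, hD⟩, hy⟩
    refine ⟨⟨C * D, fun i ↦ (norm_mul_le _ _).trans
      (mul_le_mul (hC i) (hD i) (norm_nonneg _) ((norm_nonneg _).trans (hC i)))⟩, fun b ↦ ?_⟩
    have h1 : Tendsto (fun i ↦ C * ‖y i * b - b * y i‖ + ‖x i * b - b * x i‖ * D) l (𝓝 0) := by
      simpa using ((hy b).norm.const_mul C).add ((hx b).norm.mul_const D)
    refine squeeze_zero_norm (fun i ↦ ?_) h1
    have : (x * y) i * b - b * (x * y) i =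
        x i * (y i * b - b * y i) + (x i * b - b * x i) * y i := by
      simp only [Pi.mul_apply]; noncomm_ring
    rw [this]
    refine (norm_add_le _ _).trans (add_le_add ((norm_mul_le _ _).trans ?_)
      ((norm_mul_le _ _).trans ?_))
    · gcongr; exact hC i
    · gcongr; exact hD i
  star_mem' := by
    rintro x ⟨⟨C, hC⟩, hx⟩
    refine ⟨⟨C, fun i ↦ by simpa using hC i⟩, fun b ↦ ?_⟩
    have := ((hx (star b)).star).neg
    simpa using this

variable {ι : Type*} {l : Filter ι} {B : Type*} [NonUnitalCStarAlgebra B]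

lemma tendsto_mul_zero_of_bounded {C : ℝ} {x y : ι → B} (hx : ∀ i, ‖x i‖ ≤ C)
    (hy : Tendsto y l (𝓝 0)) : Tendsto (fun i ↦ x i * y i) l (𝓝 0) := by
  refine squeeze_zero_norm (fun i ↦ ?_) (by simpa using hy.norm.const_mul C)
  exact (norm_mul_le _ _).trans (by gcongr; exact hx i)

lemma tendsto_zero_mul_of_bounded {C : ℝ} {x y : ι → B} (hx : Tendsto x l (𝓝 0))
    (hy : ∀ i, ‖y i‖ ≤ C) : Tendsto (fun i ↦ x i * y i) l (𝓝 0) := by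
  refine squeeze_zero_norm (fun i ↦ ?_) (by simpa using hx.norm.mul_const C)
  exact (norm_mul_le _ _).trans (by gcongr; exact hy i)

lemma tendsto_zero_of_star {x : ι → B} (hx : Tendsto (fun i ↦ star (x i)) l (𝓝 0)) :
    Tendsto x l (𝓝 0) := by
  simpa using hx.star

/-- A bounded net `x` with `x x⋆ → 0` tends to zero. -/
lemma tendsto_zero_of_mul_star {x : ι → B} (hx : Tendsto (fun i ↦ x i * star (x i)) l (𝓝 0)) :
    Tendsto x l (𝓝 0) := by
  refine squeeze_zero_norm (a := fun i ↦ √‖x i * star (x i)‖) (fun i ↦ ?_) ?_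
  · rw [CStarRing.norm_self_mul_star, Real.sqrt_mul_self (norm_nonneg _)]
  · simpa using hx.norm.sqrt

lemma centralNets_comm {x : ι → B} (hx : x ∈ centralNets l B) (b : B) :
    Tendsto (fun i ↦ x i * b - b * x i) l (𝓝 0) := hx.2 b

variable (l B) in
/-- The central nets that asymptotically annihilate `B`. -/
def nullNets : Submodule ℂ (ι → B) where
  carrier := {x | x ∈ centralNets l B ∧ ∀ b, Tendsto (fun i ↦ x i * b) l (𝓝 0)}
  zero_mem' := ⟨zero_mem _, fun b ↦ by simp [tendsto_const_nhds]⟩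
  add_mem' := fun {x y} hx hy ↦ ⟨add_mem hx.1 hy.1, fun b ↦ by
    simpa [add_mul] using (hx.2 b).add (hy.2 b)⟩
  smul_mem' := fun c x hx ↦ ⟨SMulMemClass.smul_mem c hx.1, fun b ↦ by
    simpa [smul_mul_assoc] using (hx.2 b).const_smul c⟩

lemma nullNets_tendsto {x : ι → B} (hx : x ∈ nullNets l B) (b : B) :
    Tendsto (fun i ↦ x i * b) l (𝓝 0) := hx.2 b

lemma nullNets_tendsto' {x : ι → B} (hx : x ∈ nullNets l B) (b : B) :
    Tendsto (fun i ↦ b * x i) l (𝓝 0) := by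
  simpa using (hx.2 b).sub (centralNets_comm hx.1 b)

lemma mem_nullNets_of_tendsto' {x : ι → B} (hx : x ∈ centralNets l B)
    (h : ∀ b, Tendsto (fun i ↦ b * x i) l (𝓝 0)) : x ∈ nullNets l B :=
  ⟨hx, fun b ↦ by simpa using (h b).add (centralNets_comm hx b)⟩

/-- With the next two lemmas: null nets form a self-adjoint two-sided ideal of the central nets, so
congruence modulo null nets is compatible with products and adjoints. -/
lemma mul_mem_nullNets_left {x y : ι → B} (hx : x ∈ centralNets l B) (hy : y ∈ nullNets l B) :
    x * y ∈ nullNets l B := by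
  refine ⟨mul_mem hx hy.1, fun b ↦ ?_⟩
  obtain ⟨C, hC⟩ := hx.1
  simpa [mul_assoc] using tendsto_mul_zero_of_bounded hC (hy.2 b)

lemma mul_mem_nullNets_right {x y : ι → B} (hx : x ∈ nullNets l B) (hy : y ∈ centralNets l B) :
    x * y ∈ nullNets l B := by
  refine mem_nullNets_of_tendsto' (mul_mem hx.1 hy) fun b ↦ ?_
  obtain ⟨C, hC⟩ := hy.1
  simpa [mul_assoc] using tendsto_zero_mul_of_bounded (nullNets_tendsto' hx b) hC

lemma star_mem_nullNets {x : ι → B} (hx : x ∈ nullNets l B) : star x ∈ nullNets l B := by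
  refine mem_nullNets_of_tendsto' (star_mem hx.1) fun b ↦ tendsto_zero_of_star ?_
  simpa using hx.2 (star b)

/-- A net that is asymptotically a unit for `B`. -/
def IsUnitNet (l : Filter ι) (e : ι → B) : Prop := ∀ b, Tendsto (fun i ↦ e i * b) l (𝓝 b)

lemma IsUnitNet.congr {e f : ι → B} (he : IsUnitNet l e) (h : f - e ∈ nullNets l B) :
    IsUnitNet l f := fun b ↦ by
  simpa [sub_mul] using (nullNets_tendsto h b).add (he b)

lemma IsUnitNet.mul_sub_mem {e x : ι → B} (he : IsUnitNet l e) (hc : e ∈ centralNets l B)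
    (hx : x ∈ centralNets l B) : x * e - x ∈ nullNets l B := by
  refine ⟨sub_mem (mul_mem hx hc) hx, fun b ↦ ?_⟩
  obtain ⟨C, hC⟩ := hx.1
  have : Tendsto (fun i ↦ e i * b - b) l (𝓝 0) := by simpa using (he b).sub_const b
  simpa [mul_sub, sub_mul, mul_assoc] using tendsto_mul_zero_of_bounded hC this

/-- For self-adjoint `e`, taking adjoints in `e b⋆ → b⋆` gives `b e → b`, so both products have the
same limit. -/
lemma IsUnitNet.mem_centralNets {e : ι → B} (he : IsUnitNet l e) (hs : ∀ i, star (e i) = e i)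
    (hb : ∃ C, ∀ i, ‖e i‖ ≤ C) : e ∈ centralNets l B := by
  refine ⟨hb, fun b ↦ ?_⟩
  simpa [hs] using (he b).sub (he (star b)).star

/-- `*`-automorphisms preserve norms. -/
lemma StarAlgEquiv.norm_apply_eq (θ : B ≃⋆ₐ[ℂ] B) (b : B) : ‖θ b‖ = ‖b‖ :=
  NonUnitalStarAlgHom.norm_map θ θ.injective b

lemma comp_mem_centralNets (θ : B ≃⋆ₐ[ℂ] B) {x : ι → B} (hx : x ∈ centralNets l B) :
    (fun i ↦ θ (x i)) ∈ centralNets l B := by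
  obtain ⟨C, hC⟩ := hx.1
  refine ⟨⟨C, fun i ↦ by rw [θ.norm_apply_eq]; exact hC i⟩, fun b ↦ ?_⟩
  have h := hx.2 (θ.symm b)
  rw [tendsto_zero_iff_norm_tendsto_zero] at h ⊢
  refine h.congr fun i ↦ ?_
  rw [← θ.norm_apply_eq]; simp

lemma comp_mem_nullNets (θ : B ≃⋆ₐ[ℂ] B) {x : ι → B} (hx : x ∈ nullNets l B) :
    (fun i ↦ θ (x i)) ∈ nullNets l B := by
  refine ⟨comp_mem_centralNets θ hx.1, fun b ↦ ?_⟩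
  have h := hx.2 (θ.symm b)
  rw [tendsto_zero_iff_norm_tendsto_zero] at h ⊢
  refine h.congr fun i ↦ ?_
  rw [← θ.norm_apply_eq]; simp

/-! ### Lifting to central nets and to contractions by order and functional calculus. -/

section Order

attribute [local instance] CStarAlgebra.spectralOrder CStarAlgebra.spectralOrderedRing

/-- Self-adjoint nets that commute with `B` in the weak sense are central. -/
lemma mem_centralNets_of_isSelfAdjoint {x : ι → B} (hs : ∀ i, star (x i) = x i)
    (hb : ∃ C, ∀ i, ‖x i‖ ≤ C)
    (h : ∀ a b, Tendsto (fun i ↦ (x i * b - b * x i) * a) l (𝓝 0)) : x ∈ centralNets l B := by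
  refine ⟨hb, fun b ↦ ?_⟩
  have h' : ∀ a b, Tendsto (fun i ↦ a * (x i * b - b * x i)) l (𝓝 0) := fun a b ↦ by
    refine tendsto_zero_of_star ?_
    simpa [hs, sub_mul] using (h (star a) (star b)).neg
  -- Positive elements `c⋆c` span `B`, and `[x, c⋆c] = [x, c⋆]c + c⋆[x, c]`: each commutator comes
  -- with a factor that the weak hypothesis or its adjoint can absorb.
  have hmem : b ∈ Submodule.span ℂ {a : B | 0 ≤ a} := by rw [CStarAlgebra.span_nonneg]; trivial
  induction hmem using Submodule.span_induction with
  | mem b hb' =>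
    obtain ⟨c, rfl⟩ := CStarAlgebra.nonneg_iff_eq_star_mul_self.1 (show 0 ≤ b from hb')
    have := (h c (star c)).add (h' (star c) c)
    rw [add_zero] at this
    exact this.congr fun i ↦ by noncomm_ring
  | zero => simp [tendsto_const_nhds]
  | add b c _ _ hb hc => simpa [add_mul, mul_add, add_sub_add_comm] using hb.add hc
  | smul z b _ hb => simpa [smul_sub, smul_mul_assoc, mul_smul_comm] using hb.const_smul z

lemma IsPositiveElem.star_eq {a : B} (ha : IsPositiveElem a) : star a = a := by
  obtain ⟨b, rfl⟩ := ha; simp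

/-- For `w ∈ B` and `r = w⋆w(1 + w⋆w)⁻¹`, the element `2w(1 + w⋆w)⁻¹ = 2(w - wr)` is a
contraction. -/
lemma exists_normalization (w : B) : ∃ r : B, ‖r‖ ≤ 1 ∧ star r = r ∧
    r * (star w * w) + r = star w * w ∧ ‖(2 : ℂ) • (w - w * r)‖ ≤ 1 := by
  set c := star w * w with hc
  have hc0 : 0 ≤ c := star_mul_self_nonneg w
  have hsa : IsSelfAdjoint c := IsSelfAdjoint.star_mul_self w
  have hsp : ∀ t ∈ quasispectrum ℝ c, 0 ≤ t := fun t ht ↦ quasispectrum_nonneg_of_nonneg c hc0 t ht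
  -- The absolute value only serves to make `f` continuous on all of `ℝ`; the quasispectrum of `c`
  -- is nonnegative. The non-unital calculus also needs `f 0 = 0`.
  obtain ⟨f, hf, hfa⟩ : ∃ f : ℝ → ℝ, Continuous f ∧ ∀ t, 0 ≤ t → f t = t / (1 + t) :=
    ⟨fun t ↦ t / (1 + |t|), continuous_id.div (by fun_prop) fun t ↦ by positivity,
      fun t ht ↦ by simp only [abs_of_nonneg ht]⟩
  have hf0 : f 0 = 0 := by simp [hfa]
  have hft : ∀ t, 0 ≤ t → f t * t + f t = t := fun t ht ↦ by
    rw [hfa t ht]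
    field_simp
    ring
  set r := cfcₙ f c with hr
  have hrs : star r = r := (IsSelfAdjoint.cfcₙ (f := f) (a := c))
  have hidc : cfcₙ (fun t : ℝ ↦ t) c = c := cfcₙ_id' ℝ c
  refine ⟨r, ?_, hrs, ?_, ?_⟩
  · refine norm_cfcₙ_le fun t ht ↦ ?_
    have := hsp t ht
    rw [hfa t this, Real.norm_eq_abs, abs_of_nonneg (by positivity), div_le_one (by positivity)]
    linarith
  · have h1 : cfcₙ (fun t ↦ f t * t + f t) c = r * c + r := by
      rw [cfcₙ_add (fun t ↦ f t * t) f c (hf.mul continuous_id).continuousOn (by simp)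
        hf.continuousOn hf0, cfcₙ_mul f (fun t ↦ t) c hf.continuousOn hf0 continuousOn_id rfl, hidc]
    rw [← h1]
    conv_rhs => rw [← hidc]
    exact cfcₙ_congr fun t ht ↦ hft t (hsp t ht)
  · have h1 : cfcₙ (fun t : ℝ ↦ (t - t * f t) - f t * (t - t * f t)) c =
        (c - c * r) - r * (c - c * r) := by
      have h2 : cfcₙ (fun t : ℝ ↦ t - t * f t) c = c - c * r := by
        rw [cfcₙ_sub (fun t : ℝ ↦ t) (fun t ↦ t * f t) c continuousOn_id rfl
          (continuous_id.mul hf).continuousOn (by simp),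
          cfcₙ_mul (fun t : ℝ ↦ t) f c continuousOn_id rfl hf.continuousOn hf0, hidc]
      have h2c : Continuous fun t : ℝ ↦ t - t * f t := by fun_prop
      rw [cfcₙ_sub (fun t : ℝ ↦ t - t * f t) (fun t ↦ f t * (t - t * f t)) c h2c.continuousOn
        (by simp) (hf.mul h2c).continuousOn (by simp),
        cfcₙ_mul f (fun t : ℝ ↦ t - t * f t) c hf.continuousOn hf0 h2c.continuousOn (by simp), h2]
    have h3 : star (w - w * r) * (w - w * r) = (c - c * r) - r * (c - c * r) := by
      rw [star_sub, star_mul, hrs, hc]; noncomm_ring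
    -- The square is the functional calculus of `t / (1 + t)²`, which is at most `1/4` on `t ≥ 0`
    -- because `(t - 1)² ≥ 0`. This is why the factor `2` still leaves a contraction.
    have h4 : ‖star (w - w * r) * (w - w * r)‖ ≤ 1 / 4 := by
      rw [h3, ← h1]
      refine norm_cfcₙ_le fun t ht ↦ ?_
      have ht0 := hsp t ht
      have : (t - t * f t) - f t * (t - t * f t) = t / (1 + t) ^ 2 := by
        rw [hfa t ht0]
        field_simp
        ring
      rw [this, Real.norm_eq_abs, abs_of_nonneg (by positivity), div_le_div_iff₀ (by positivity)
        (by positivity)]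
      nlinarith [sq_nonneg (t - 1)]
    rw [CStarRing.norm_star_mul_self] at h4
    rw [norm_smul]
    simp only [Complex.norm_ofNat]
    nlinarith [norm_nonneg (w - w * r)]

/-- A central net that is asymptotically an isometry agrees asymptotically with a net of
contractions. -/
lemma exists_contraction_net {w : ι → B} (hw : w ∈ centralNets l B)
    (hu : IsUnitNet l (star w * w)) :
    ∃ v ∈ centralNets l B, (∀ i, ‖v i‖ ≤ 1) ∧ v - w ∈ nullNets l B := by
  choose r hr1 hrs hrc hrn using fun i ↦ exists_normalization (w i)
  -- With `c = w⋆w` and `rc + r = c` one has `2rb - b = (cb - b) - r(cb - b)`. So `2r` is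
  -- asymptotically a unit and `2(w - wr)` agrees with `2w - w = w`.
  have hr : ∀ b, Tendsto (fun i ↦ (2 : ℂ) • (r i * b) - b) l (𝓝 0) := fun b ↦ by
    have h0 : Tendsto (fun i ↦ star (w i) * w i * b - b) l (𝓝 0) := by
      simpa using (hu b).sub_const b
    have h1 := h0.sub (tendsto_mul_zero_of_bounded hr1 h0)
    rw [sub_zero] at h1
    refine h1.congr fun i ↦ ?_
    have h2 : r i * (star (w i) * w i) * b + r i * b = star (w i) * w i * b := by
      rw [← add_mul, hrc]
    rw [mul_sub, ← mul_assoc (r i), two_smul, ← h2]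
    abel
  have hr2 : IsUnitNet l ((2 : ℂ) • r) := fun b ↦ by
    simpa [smul_mul_assoc] using (hr b).add_const b
  have hrC : (2 : ℂ) • r ∈ centralNets l B := by
    refine hr2.mem_centralNets (fun i ↦ by simp [hrs]) ⟨2, fun i ↦ ?_⟩
    simp only [Pi.smul_apply, norm_smul, Complex.norm_ofNat]
    linarith [hr1 i]
  refine ⟨(2 : ℂ) • w - w * ((2 : ℂ) • r), sub_mem (SMulMemClass.smul_mem _ hw) (mul_mem hw hrC),
    fun i ↦ ?_, ?_⟩
  · simpa [smul_sub, mul_smul_comm] using hrn i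
  · have := Submodule.neg_mem _ (hr2.mul_sub_mem hrC hw)
    convert this using 1
    rw [two_smul]
    abel

/-- Contractive central nets that are asymptotically inverse to each other are asymptotically
adjoint to each other. -/
lemma star_sub_mem_nullNets {x y : ι → B} (hx : x ∈ centralNets l B) (hy : y ∈ centralNets l B)
    (hx1 : ∀ i, ‖x i‖ ≤ 1) (hy1 : ∀ i, ‖y i‖ ≤ 1) (hyx : IsUnitNet l (y * x)) :
    star x - y ∈ nullNets l B := by
  have key : ∀ a b : B, ‖a‖ ≤ 1 → b * (star a * a) * star b ≤ b * star b := fun a b ha ↦ by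
    have h1 : ‖star a * a‖ ≤ 1 := by
      rw [CStarRing.norm_star_mul_self]; nlinarith [norm_nonneg a]
    refine (CStarAlgebra.star_right_conjugate_le_norm_smul
      (hb := IsSelfAdjoint.star_mul_self a)).trans ?_
    calc ‖star a * a‖ • (b * star b) ≤ (1 : ℝ) • (b * star b) :=
          smul_le_smul_of_nonneg_right h1 (mul_star_self_nonneg b)
      _ = b * star b := one_smul _ _
  have hz := sub_mem (star_mem hx) hy
  refine mem_nullNets_of_tendsto' hz fun b ↦ tendsto_zero_of_mul_star ?_
  -- Let `s = b(b⋆ - yxb⋆)`. Expanding `b(x⋆ - y)(x⋆ - y)⋆b⋆` and bounding `b x⋆x b⋆` and `b yy⋆ b⋆`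
  -- by `bb⋆` shows that it is at most `s + s⋆`, and `s → 0`.
  have hs : Tendsto (fun i ↦ b * (star b - y i * x i * star b)) l (𝓝 0) := by
    simpa using ((hyx (star b)).const_sub (star b)).const_mul b
  have hS := (hs.add hs.star).norm
  rw [star_zero, add_zero, norm_zero] at hS
  refine squeeze_zero_norm (fun i ↦ ?_) hS
  refine CStarAlgebra.norm_le_norm_of_nonneg_of_le (mul_star_self_nonneg _) ?_
  have h1 := add_le_add (key (x i) b (hx1 i)) (key (star (y i)) b (by simpa using hy1 i))
  rw [← sub_nonneg] at h1 ⊢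
  convert h1 using 1
  simp only [Pi.sub_apply, Pi.star_apply, star_mul, star_sub, star_star]
  noncomm_ring

end Order

end Approx

/-- Congruences multiply: `xy - x'y' = (x - x')y + x'(y - y')`. -/
lemma sub_mul_mem_nullNets {ι : Type*} {l : Filter ι} {B : Type*} [NonUnitalCStarAlgebra B]
    {x x' y y' : ι → B} (hx : x - x' ∈ nullNets l B) (hy : y - y' ∈ nullNets l B)
    (hx' : x' ∈ centralNets l B) (hyc : y ∈ centralNets l B) :
    x * y - x' * y' ∈ nullNets l B := by
  have := add_mem (mul_mem_nullNets_right hx hyc) (mul_mem_nullNets_left hx' hy)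
  convert this using 1
  noncomm_ring

lemma nullNets_trans {ι : Type*} {l : Filter ι} {B : Type*} [NonUnitalCStarAlgebra B]
    {x y z : ι → B} (hx : x - y ∈ nullNets l B) (hy : y - z ∈ nullNets l B) :
    x - z ∈ nullNets l B := by
  simpa using add_mem hx hy

lemma nullNets_symm {ι : Type*} {l : Filter ι} {B : Type*} [NonUnitalCStarAlgebra B]
    {x y : ι → B} (hx : x - y ∈ nullNets l B) : y - x ∈ nullNets l B := by
  simpa using neg_mem hx

/-! ### Orthogonality relations for characters with values in the circle. -/

section Characters

variable {G : Type*} [CommGroup G] [Fintype G]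

/-- Complex characters separate points, and their values are roots of unity, hence lie on the
circle. -/
lemma exists_circle_char_ne_one {g : G} (hg : g ≠ 1) : ∃ χ : G →* Circle, χ g ≠ 1 := by
  obtain ⟨φ, hφ⟩ := CommGroup.exists_apply_ne_one_of_hasEnoughRootsOfUnity G ℂ hg
  have hn : ∀ h : G, ‖(φ h : ℂ)‖ = 1 := fun h ↦
    Complex.norm_eq_one_of_pow_eq_one (n := Fintype.card G)
      (by rw [← Units.val_pow_eq_pow_val, ← map_pow, pow_card_eq_one, map_one, Units.val_one])
      Fintype.card_ne_zero
  refine ⟨{ toFun := fun h ↦ ⟨φ h, mem_sphere_zero_iff_norm.2 (hn h)⟩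
            map_one' := Circle.ext (by simp)
            map_mul' := fun a b ↦ Circle.ext (show (φ (a * b) : ℂ) = φ a * φ b by simp) }, fun h ↦ hφ ?_⟩
  exact Units.ext (congrArg ((↑) : Circle → ℂ) h)

open Classical in
-- Translating the sum by a character `τ` with `τ(g) ≠ 1` multiplies it by `τ(g)`, so it vanishes.
lemma sum_circle_char_apply (g : G) :
    ∑ χ : G →* Circle, (χ g : ℂ) = if g = 1 then (Fintype.card (G →* Circle) : ℂ) else 0 := by
  split_ifs with h
  · simp [h]
  · obtain ⟨τ, hτ⟩ := exists_circle_char_ne_one h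
    have h1 := Equiv.sum_comp (Equiv.mulLeft τ) fun χ : G →* Circle ↦ (χ g : ℂ)
    simp only [Equiv.coe_mulLeft, MonoidHom.mul_apply, Circle.coe_mul, ← Finset.mul_sum] at h1
    by_contra h2
    exact hτ (Circle.ext ((mul_eq_right₀ h2).1 h1))

open Classical in
lemma sum_circle_char (χ : G →* Circle) :
    ∑ g : G, (χ g : ℂ) = if χ = 1 then (Fintype.card G : ℂ) else 0 := by
  split_ifs with h
  · simp [h]
  · obtain ⟨a, ha⟩ := DFunLike.ne_iff.1 h
    have h1 := Equiv.sum_comp (Equiv.mulLeft a) fun g : G ↦ (χ g : ℂ)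
    simp only [Equiv.coe_mulLeft, map_mul, Circle.coe_mul, ← Finset.mul_sum] at h1
    by_contra h2
    exact ha (Circle.ext ((mul_eq_right₀ h2).1 h1))

/-- The double sum of all `χ(g)`, evaluated in both orders by the orthogonality relations, equals
either cardinality. -/
lemma card_circle_char : (Fintype.card (G →* Circle) : ℂ) = Fintype.card G := by
  classical
  have h := Finset.sum_comm (s := Finset.univ) (t := Finset.univ)
    (f := fun (χ : G →* Circle) (g : G) ↦ (χ g : ℂ))
  simp only [sum_circle_char_apply, sum_circle_char] at h
  simpa using h.symm

lemma circle_char_mul_inv {G : Type*} [Group G] (χ : G →* Circle) (g : G) :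
    (χ g : ℂ) * (χ g⁻¹ : ℂ) = 1 := by
  rw [map_inv, Circle.coe_inv, mul_inv_cancel₀ (Circle.coe_ne_zero _)]

lemma circle_char_inv_mul {G : Type*} [Group G] (χ : G →* Circle) (g : G) :
    (χ g⁻¹ : ℂ) * (χ g : ℂ) = 1 := by
  rw [mul_comm, circle_char_mul_inv]

end Characters

namespace PartialAction

/-! ### Monomials `a u_g`, and asymptotic representations in the crossed product. -/

section Mono

variable {G A : Type*} [Group G] [NonUnitalCStarAlgebra A] {α : PartialAction G A}

namespace IsGlobal

lemma mem (hα : α.IsGlobal) (g : G) (a : A) : a ∈ α.ideal g := by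
  rw [hα g]; trivial

lemma act_mul (hα : α.IsGlobal) (g : G) (a b : A) : α.act g (a * b) = α.act g a * α.act g b :=
  α.act_mul g (hα.mem _ _) (hα.mem _ _)

lemma act_sub (hα : α.IsGlobal) (g : G) (a b : A) : α.act g (a - b) = α.act g a - α.act g b := by
  rw [eq_sub_iff_add_eq, ← α.act_add g (hα.mem _ _) (hα.mem _ _), sub_add_cancel]

lemma act_star (hα : α.IsGlobal) (g : G) (a : A) : α.act g (star a) = star (α.act g a) :=
  α.act_star g (hα.mem _ _)

lemma act_act (hα : α.IsGlobal) (g h : G) (a : A) : α.act g (α.act h a) = α.act (g * h) a :=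
  (α.act_act g h (hα.mem _ _) (hα.mem _ _)).2.symm

lemma act_act_inv (hα : α.IsGlobal) (g : G) (a : A) : α.act g (α.act g⁻¹ a) = a :=
  α.act_act_inv g (hα.mem _ _)

lemma norm_act (hα : α.IsGlobal) (g : G) (a : A) : ‖α.act g a‖ = ‖a‖ :=
  α.norm_act g (hα.mem _ _)

lemma tendsto_act (hα : α.IsGlobal) {ι : Type*} {l : Filter ι} (g : G) {u : ι → A}
    (hu : Tendsto u l (𝓝 0)) : Tendsto (fun i ↦ α.act g (u i)) l (𝓝 0) := by
  rw [tendsto_zero_iff_norm_tendsto_zero] at hu ⊢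
  exact hu.congr fun i ↦ (hα.norm_act g _).symm

lemma conv_eq (hα : α.IsGlobal) (g : G) (a b : A) : α.conv g a b = a * α.act g b := by
  rw [conv, hα.act_mul, hα.act_act_inv]

open Classical in
/-- The element `a u_g` of the crossed product by a global action. -/
noncomputable def mono (hα : α.IsGlobal) (g : G) (a : A) : α.CrossedProduct :=
  CrossedProduct.single g ⟨a, hα.mem g a⟩

variable (hα : α.IsGlobal)

lemma mono_apply_same (g : G) (a : A) : (hα.mono g a g : A) = a :=
  by classical exact CrossedProduct.single_same _ _

lemma mono_apply_ne {g h : G} (e : h ≠ g) (a : A) : (hα.mono g a h : A) = 0 :=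
  by classical exact CrossedProduct.single_ne e _

lemma mono_coeff {g : G} {x : α.CrossedProduct} (hx : ∀ h, h ≠ g → (x h : A) = 0) :
    hα.mono g (x g) = x := by
  ext h
  by_cases e : h = g
  · subst e; rw [mono_apply_same]
  · rw [mono_apply_ne hα e, hx h e]

lemma mono_sub (g : G) (a b : A) : hα.mono g (a - b) = hα.mono g a - hα.mono g b := by
  rw [eq_sub_iff_add_eq]
  ext h
  rw [CrossedProduct.add_apply]
  by_cases e : h = g
  · subst e; simp [mono_apply_same]
  · simp [mono_apply_ne hα e]

lemma star_mono (g : G) (a : A) :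
    star (hα.mono g a) = hα.mono g⁻¹ (α.act g⁻¹ (star a)) :=
  by classical exact CrossedProduct.star_single _ _

variable [Fintype G]

lemma mono_mul_mono (g h : G) (a b : A) :
    hα.mono g a * hα.mono h b = hα.mono (g * h) (a * α.act g b) := by
  classical
  have := CrossedProduct.single_mul_single g h ⟨a, hα.mem g a⟩ ⟨b, hα.mem h b⟩
  simp only [hα.conv_eq] at this
  exact this

lemma sum_mono (x : α.CrossedProduct) : ∑ g, hα.mono g (x g) = x := by
  classical
  conv_rhs => rw [← CrossedProduct.sum_single x]
  unfold mono
  congr!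

lemma norm_mono_one_le (a : A) : ‖hα.mono 1 a‖ ≤ ‖a‖ := by
  let φ : A →⋆ₙₐ[ℂ] α.CrossedProduct :=
    { toFun := hα.mono 1
      map_smul' := fun c a ↦ by
        ext h
        rw [CrossedProduct.smul_apply]
        by_cases e : h = 1
        · subst e; simp [mono_apply_same]
        · simp [mono_apply_ne hα e]
      map_zero' := by simpa using hα.mono_sub 1 0 0
      map_add' := fun a b ↦ by
        have := hα.mono_sub 1 (a + b) b
        rw [add_sub_cancel_right] at this
        rw [this, sub_add_cancel]
      map_mul' := fun a b ↦ by rw [mono_mul_mono, one_mul, act_one]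
      map_star' := fun a ↦ by rw [star_mono, inv_one, act_one] }
  exact NonUnitalStarAlgHom.norm_apply_le φ a

/-- The upper bound reduces to `g = 1` since `(a u_g)(a u_g)⋆ = aa⋆ u_1`; the lower bound holds
because taking a coefficient is contractive. Limits of monomials can thus be computed in `A`. -/
lemma norm_mono (g : G) (a : A) : ‖hα.mono g a‖ = ‖a‖ := by
  refine le_antisymm ?_ ?_
  · have h : ‖hα.mono g a * star (hα.mono g a)‖ ≤ ‖a * star a‖ := by
      rw [star_mono, mono_mul_mono, mul_inv_cancel, hα.act_act_inv]
      exact hα.norm_mono_one_le _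
    rw [CStarRing.norm_self_mul_star, CStarRing.norm_self_mul_star] at h
    exact (mul_self_le_mul_self_iff (norm_nonneg _) (norm_nonneg _)).2 h
  · simpa [mono_apply_same] using CrossedProduct.norm_coeff_le (hα.mono g a) g

lemma tendsto_mono_iff {ι : Type*} {l : Filter ι} (g : G) {u : ι → A} :
    Tendsto (fun i ↦ hα.mono g (u i)) l (𝓝 0) ↔ Tendsto u l (𝓝 0) := by
  rw [tendsto_zero_iff_norm_tendsto_zero, tendsto_zero_iff_norm_tendsto_zero (f := u)]
  simp only [norm_mono]

end IsGlobal

end Mono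

/-- A net of approximate representations of `G` in the crossed product that asymptotically commute
with the crossed product, the image of `g` being of the form `a u_g`. -/
structure IsDualRep {G A ι : Type*} [Group G] [Fintype G] [NonUnitalCStarAlgebra A]
    (α : PartialAction G A) (l : Filter ι) (V : G → ι → α.CrossedProduct) : Prop where
  central : ∀ g, V g ∈ centralNets l α.CrossedProduct
  norm_le : ∀ g i, ‖V g i‖ ≤ 1
  apply_ne : ∀ g i h, h ≠ g → (V g i h : A) = 0
  mul : ∀ g h, V g * V h - V (g * h) ∈ nullNets l α.CrossedProduct
  unit : IsUnitNet l (V 1)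

namespace IsDualRep

variable {G A ι : Type*} [Group G] [Fintype G] [NonUnitalCStarAlgebra A]
    {α : PartialAction G A} {l : Filter ι} {V : G → ι → α.CrossedProduct}

lemma unit_mul (hV : α.IsDualRep l V) {g h : G} (e : g * h = 1) : IsUnitNet l (V g * V h) :=
  hV.unit.congr (by rw [← e]; exact hV.mul g h)

lemma star_sub (hV : α.IsDualRep l V) (g : G) :
    star (V g) - V g⁻¹ ∈ nullNets l α.CrossedProduct :=
  star_sub_mem_nullNets (hV.central g) (hV.central _) (hV.norm_le g) (hV.norm_le _)
    (hV.unit_mul (inv_mul_cancel g))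

/-- The coefficient at `1` of `V_g V_{g⁻¹} (a u_1)` converges to `a`. It lies in `A_g` because `V_g
∈ A_g u_g`, and `A_g` is closed. -/
lemma isGlobal [l.NeBot] (hV : α.IsDualRep l V) : α.IsGlobal := by
  classical
  refine fun g ↦ eq_top_iff.2 fun a _ ↦ ?_
  let b : α.CrossedProduct := CrossedProduct.single 1 ⟨a, α.mem_ideal_one a⟩
  have h := hV.unit_mul (mul_inv_cancel g) b
  have h1 : Tendsto (fun i ↦ (((V g * V g⁻¹) i * b) 1 : A)) l (𝓝 (b 1 : A)) := by
    rw [tendsto_iff_norm_sub_tendsto_zero] at h ⊢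
    refine squeeze_zero (fun _ ↦ norm_nonneg _) (fun i ↦ ?_) h
    have := CrossedProduct.norm_coeff_le ((V g * V g⁻¹) i * b - b) 1
    rwa [show (((V g * V g⁻¹) i * b - b) 1 : A) = ((V g * V g⁻¹) i * b) 1 - b 1 from
      eq_sub_of_add_eq (by rw [← CrossedProduct.add_apply, sub_add_cancel])] at this
  rw [show (b 1 : A) = a from CrossedProduct.single_same _ _] at h1
  refine (α.isClosed_ideal g).mem_of_tendsto h1 (.of_forall fun i ↦ ?_)
  rw [Pi.mul_apply, mul_assoc, CrossedProduct.mul_apply, Finset.sum_eq_single g]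
  · exact α.conv_mem_left _ _ _
  · intro h _ hh
    rw [hV.apply_ne g i h hh, α.conv_zero_left]
  · simp

end IsDualRep

end PartialAction

/-- A net indexed by a finite set `F` and a number `n` tends to zero if it is bounded by
`1 / (n + 1)` as soon as `F` is large enough. -/
lemma tendsto_zero_of_finset {B E : Type*} [SeminormedAddGroup E] (F₀ : Finset B)
    {u : Finset B × ℕ → E} (hu : ∀ p, F₀ ⊆ p.1 → ‖u p‖ < 1 / ((p.2 : ℝ) + 1)) :
    Tendsto u atTop (𝓝 0) := by
  have h1 : Tendsto (fun p : Finset B × ℕ ↦ 1 / ((p.2 : ℝ) + 1)) atTop (𝓝 0) := by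
    rw [← prod_atTop_atTop_eq]
    exact tendsto_one_div_add_atTop_nhds_zero_nat.comp tendsto_snd
  refine squeeze_zero_norm' ?_ h1
  filter_upwards [eventually_ge_atTop (F₀, 0)] with p hp
  exact (hu p hp.1).le

namespace PartialAction

/-! ### The Rokhlin property of the dual action in terms of nets. -/

section Rokhlin

variable {G A : Type*} [CommGroup G] [Fintype G] [NonUnitalCStarAlgebra A] {α : PartialAction G A}

lemma dual_act (χ : G →* Circle) (x : α.CrossedProduct) : α.dual.act χ x = α.dualAut χ x :=
  ofGlobal_act _ _ _

/-- A net of Rokhlin elements for the dual action. -/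
structure IsDualRokhlin {ι : Type*} (α : PartialAction G A) (l : Filter ι)
    (f : (G →* Circle) → ι → α.CrossedProduct) : Prop where
  star_eq : ∀ χ, star (f χ) = f χ
  central : ∀ χ, f χ ∈ centralNets l α.CrossedProduct
  orthogonal : ∀ χ τ, χ ≠ τ → f χ * f τ ∈ nullNets l α.CrossedProduct
  unit : IsUnitNet l (∑ χ, f χ)
  equivariant : ∀ χ τ, (fun i ↦ α.dualAut χ (f τ i)) - f (χ * τ) ∈ nullNets l α.CrossedProduct

lemma HasRokhlinProperty.exists_net (h : α.dual.HasRokhlinProperty) :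
    ∃ f : (G →* Circle) → Finset α.CrossedProduct × ℕ → α.CrossedProduct,
      α.IsDualRokhlin atTop f := by
  choose f hf ho hc hu he using fun p : Finset α.CrossedProduct × ℕ ↦
    h (1 / ((p.2 : ℝ) + 1)) (by positivity) p.1
  have hstar : ∀ χ p, star (f p 0 χ) = f p 0 χ := fun χ p ↦ (hf p 0 χ).2.1.star_eq
  have hbdd : ∀ χ p, ‖f p 0 χ‖ ≤ 1 := fun χ p ↦ (hf p 0 χ).2.2
  have hcen : ∀ χ, (fun p ↦ f p 0 χ) ∈ centralNets atTop α.CrossedProduct := fun χ ↦ by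
    classical
    refine mem_centralNets_of_isSelfAdjoint (hstar χ) ⟨1, hbdd χ⟩ fun a b ↦ ?_
    refine tendsto_zero_of_finset {a, b} fun p hp ↦ ?_
    exact hc p 0 χ a (hp (by simp)) b (hp (by simp))
  refine ⟨fun χ p ↦ f p 0 χ, fun χ ↦ funext (hstar χ), hcen, fun χ τ hχ ↦ ?_, fun b ↦ ?_,
    fun χ τ ↦ ?_⟩
  · refine ⟨mul_mem (hcen χ) (hcen τ), fun b ↦ tendsto_zero_of_finset {b} fun p hp ↦ ?_⟩
    exact ho p 0 χ τ hχ b (hp (by simp))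
  · rw [tendsto_iff_norm_sub_tendsto_zero, ← tendsto_zero_iff_norm_tendsto_zero]
    refine tendsto_zero_of_finset {b} fun p hp ↦ ?_
    simpa using hu p b (hp (by simp))
  · refine ⟨sub_mem (comp_mem_centralNets _ (hcen τ)) (hcen _), fun b ↦ ?_⟩
    refine tendsto_zero_of_mul_star ?_
    have h1 : Tendsto (fun p ↦ ((fun i ↦ α.dualAut χ (f i 0 τ)) - fun i ↦ f i 0 (χ * τ)) p *
        (b * star b)) atTop (𝓝 0) := by
      classical
      -- The Rokhlin condition sees the defect `D` of equivariance only between fixed elements.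
      -- Taking `x` to be the preimage of `b` and `a = b⋆` gives `D b b⋆ → 0`; multiplying by the
      -- bounded `D⋆` yields `(Db)(Db)⋆ → 0`.
      have h2 : Tendsto (fun p ↦ (α.dualAut χ (f p 0 τ * (α.dualAut χ).symm b) -
          f p 0 (χ * τ) * b) * star b) atTop (𝓝 0) := by
        refine tendsto_zero_of_finset {(α.dualAut χ).symm b, star b} fun p hp ↦ ?_
        have := he p 0 χ τ (star b) (hp (by simp)) ((α.dualAut χ).symm b) (hp (by simp)) trivial
        simpa [dual_act] using this
      refine h2.congr fun p ↦ ?_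
      simp [sub_mul, mul_assoc]
    have h3 := tendsto_zero_mul_of_bounded (C := 2) h1
      (y := fun p ↦ star (α.dualAut χ (f p 0 τ) - f p 0 (χ * τ))) fun p ↦ by
        rw [norm_star]
        refine (norm_sub_le _ _).trans ?_
        rw [StarAlgEquiv.norm_apply_eq]
        linarith [hbdd τ p, hbdd (χ * τ) p]
    refine h3.congr fun p ↦ ?_
    simp only [Pi.sub_apply, star_mul, mul_assoc]

lemma hasRokhlinProperty_of_net {ι : Type*} {l : Filter ι} [l.NeBot]
    {f : (G →* Circle) → ι → α.CrossedProduct} (h : α.IsDualRokhlin l f)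
    (hpos : ∀ χ i, IsPositiveElem (f χ i)) (hnorm : ∀ χ i, ‖f χ i‖ ≤ 1) :
    α.dual.HasRokhlinProperty := by
  intro ε hε F
  have key : ∀ {u : ι → α.CrossedProduct}, Tendsto u l (𝓝 0) → ∀ᶠ i in l, ‖u i‖ < ε := fun hu ↦ by
    have := hu.norm
    rw [norm_zero] at this
    exact this.eventually_lt_const hε
  have h1 : ∀ᶠ i in l, ∀ χ τ, χ ≠ τ → ∀ a ∈ F, ‖f χ i * f τ i * a‖ < ε := by
    simp only [eventually_all, eventually_all_finset]
    exact fun χ τ hχ a _ ↦ key (nullNets_tendsto (h.orthogonal χ τ hχ) a)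
  have h2 : ∀ᶠ i in l, ∀ χ, ∀ a ∈ F, ∀ b ∈ F, ‖(f χ i * b - b * f χ i) * a‖ < ε := by
    simp only [eventually_all, eventually_all_finset]
    exact fun χ a _ b _ ↦ key (by simpa using (centralNets_comm (h.central χ) b).mul_const a)
  have h3 : ∀ᶠ i in l, ∀ a ∈ F, ‖(∑ χ, f χ i) * a - a‖ < ε := by
    simp only [eventually_all_finset]
    exact fun a _ ↦ key (by simpa using (h.unit a).sub_const a)
  have h4 : ∀ᶠ i in l, ∀ χ τ, ∀ a ∈ F, ∀ x ∈ F,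
      ‖(α.dualAut χ (f τ i * x) - f (χ * τ) i * α.dualAut χ x) * a‖ < ε := by
    simp only [eventually_all, eventually_all_finset]
    refine fun χ τ a _ x _ ↦ key ?_
    have := (nullNets_tendsto (h.equivariant χ τ) (α.dualAut χ x)).mul_const a
    simpa [sub_mul] using this
  obtain ⟨i, h1, h2, h3, h4⟩ := (h1.and (h2.and (h3.and h4))).exists
  refine ⟨fun _ χ ↦ f χ i, fun _ χ ↦ ⟨trivial, hpos χ i, hnorm χ i⟩, fun _ ↦ h1, fun _ ↦ h2,
    fun a ha ↦ by simpa using h3 a ha, fun _ χ τ a ha x hx _ ↦ ?_⟩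
  rw [dual_act, dual_act]
  exact h4 χ τ a ha x hx

end Rokhlin

/-! ### Fourier transform: from Rokhlin elements to an asymptotic representation. -/

section RokhlinToDualRep

variable {G A ι : Type*} [CommGroup G] [Fintype G] [NonUnitalCStarAlgebra A]
  {α : PartialAction G A} {l : Filter ι} {f : (G →* Circle) → ι → α.CrossedProduct}

/-- The projection onto the spectral subspace `A_g u_g`. -/
lemma average_dualAut_apply (g h : G) (x : α.CrossedProduct) :
    (((Fintype.card (G →* Circle) : ℂ)⁻¹ • ∑ τ : G →* Circle, (τ g⁻¹ : ℂ) • α.dualAut τ x :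
      α.CrossedProduct) h : A) = open Classical in if h = g then (x h : A) else 0 := by
  classical
  have hs : ∀ s : Finset (G →* Circle),
      ((∑ τ ∈ s, (τ g⁻¹ : ℂ) • α.dualAut τ x : α.CrossedProduct) h : A) =
        (∑ τ ∈ s, (τ (g⁻¹ * h) : ℂ)) • (x h : A) := fun s ↦ by
    induction s using Finset.induction_on with
    | empty => simp
    | insert τ s hτ ih =>
      rw [Finset.sum_insert hτ, Finset.sum_insert hτ, CrossedProduct.add_apply, ih, add_smul,
        CrossedProduct.smul_apply, dualAut_apply, smul_smul, map_mul, Circle.coe_mul]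
  rw [CrossedProduct.smul_apply, hs, sum_circle_char_apply, smul_smul]
  by_cases e : h = g
  · subst e
    simp
  · have : g⁻¹ * h ≠ 1 := fun h' ↦ e (inv_mul_eq_one.1 h').symm
    simp [e, this]

namespace IsDualRokhlin

/-- The asymptotic representation `g ↦ ∑ χ, χ(g)⁻¹ f_χ`. -/
noncomputable def rep (f : (G →* Circle) → ι → α.CrossedProduct) (g : G) : ι → α.CrossedProduct :=
  ∑ χ : G →* Circle, (χ g⁻¹ : ℂ) • f χ

lemma rep_central (h : α.IsDualRokhlin l f) (g : G) :
    rep f g ∈ centralNets l α.CrossedProduct :=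
  sum_mem fun χ _ ↦ SMulMemClass.smul_mem _ (h.central χ)

lemma rep_one : rep f 1 = ∑ χ, f χ := by simp [rep]

lemma rep_unit (h : α.IsDualRokhlin l f) : IsUnitNet l (rep f 1) := by
  rw [rep_one]; exact h.unit

lemma star_rep (h : α.IsDualRokhlin l f) (g : G) : star (rep f g) = rep f g⁻¹ := by
  simp only [rep, star_sum, star_smul, h.star_eq]
  refine Finset.sum_congr rfl fun χ _ ↦ ?_
  rw [map_inv, Circle.coe_inv_eq_conj]
  simp

/-- Multiplying the unit `∑ τ, f_τ` by `f_χ` leaves only `f_χ²`, by orthogonality. -/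
lemma mul_self_sub (h : α.IsDualRokhlin l f) (χ : G →* Circle) :
    f χ * f χ - f χ ∈ nullNets l α.CrossedProduct := by
  classical
  have h1 := h.unit.mul_sub_mem (sum_mem fun χ _ ↦ h.central χ) (h.central χ)
  have h2 : ∑ τ ∈ Finset.univ.erase χ, f χ * f τ ∈ nullNets l α.CrossedProduct :=
    sum_mem fun τ hτ ↦ h.orthogonal χ τ (Finset.ne_of_mem_erase hτ).symm
  rw [Finset.mul_sum, ← Finset.add_sum_erase _ _ (Finset.mem_univ χ)] at h1
  simpa [add_sub_right_comm] using sub_mem h1 h2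

lemma rep_mul (h : α.IsDualRokhlin l f) (g k : G) :
    rep f g * rep f k - rep f (g * k) ∈ nullNets l α.CrossedProduct := by
  classical
  have h1 : ∀ χ τ, f χ * f τ - (if χ = τ then f χ else 0) ∈ nullNets l α.CrossedProduct := by
    intro χ τ
    split_ifs with e
    · subst e; exact h.mul_self_sub χ
    · simpa using h.orthogonal χ τ e
  have h2 : ∑ χ, ∑ τ, ((χ g⁻¹ : ℂ) * (τ k⁻¹ : ℂ)) • (f χ * f τ - (if χ = τ then f χ else 0)) ∈
      nullNets l α.CrossedProduct :=
    sum_mem fun χ _ ↦ sum_mem fun τ _ ↦ Submodule.smul_mem _ _ (h1 χ τ)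
  convert h2 using 1
  simp only [rep, Finset.sum_mul_sum, smul_sub, Finset.sum_sub_distrib, smul_mul_smul_comm,
    smul_ite, smul_zero, Finset.sum_ite_eq, Finset.mem_univ, if_true]
  congr 1
  refine Finset.sum_congr rfl fun χ _ ↦ ?_
  rw [mul_inv, map_mul, Circle.coe_mul]

/-- Applying `τ` shifts the index of `f`; shifting the summation back releases the factor `τ(g)`. -/
lemma rep_equivariant (h : α.IsDualRokhlin l f) (τ : G →* Circle) (g : G) :
    (fun i ↦ α.dualAut τ (rep f g i)) - (τ g : ℂ) • rep f g ∈ nullNets l α.CrossedProduct := by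
  have h1 : ∑ χ : G →* Circle, (χ g⁻¹ : ℂ) • ((fun i ↦ α.dualAut τ (f χ i)) - f (τ * χ)) ∈
      nullNets l α.CrossedProduct :=
    sum_mem fun χ _ ↦ Submodule.smul_mem _ _ (h.equivariant τ χ)
  convert h1 using 1
  simp only [smul_sub, Finset.sum_sub_distrib]
  congr 1
  · funext i
    simp [rep, Finset.sum_apply, map_sum]
  · rw [rep, ← Equiv.sum_comp (Equiv.mulLeft τ), Finset.smul_sum]
    refine Finset.sum_congr rfl fun χ _ ↦ ?_
    rw [smul_smul, Equiv.coe_mulLeft, MonoidHom.mul_apply, Circle.coe_mul, ← mul_assoc,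
      circle_char_mul_inv, one_mul]

lemma exists_isDualRep (h : α.IsDualRokhlin l f) : ∃ V : G → ι → α.CrossedProduct,
    α.IsDualRep l V ∧ ∀ i, IsPositiveElem (V 1 i 1 : A) := by
  have hu : ∀ g, IsUnitNet l (star (rep f g) * rep f g) := fun g ↦ by
    rw [h.star_rep]
    exact h.rep_unit.congr (by simpa using h.rep_mul g⁻¹ g)
  choose v hvc hv1 hv using fun g ↦ exists_contraction_net (h.rep_central g) (hu g)
  have hve : ∀ (τ : G →* Circle) g,
      (fun i ↦ α.dualAut τ (v g i)) - (τ g : ℂ) • v g ∈ nullNets l α.CrossedProduct := by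
    intro τ g
    have h1 := comp_mem_nullNets (α.dualAut τ) (hv g)
    have h2 := Submodule.smul_mem _ (τ g : ℂ) (hv g)
    have h3 := sub_mem (add_mem h1 (h.rep_equivariant τ g)) h2
    convert h3 using 1
    funext i
    simp only [Pi.sub_apply, Pi.add_apply, Pi.smul_apply, map_sub, smul_sub]
    abel
  let n : ℂ := Fintype.card (G →* Circle)
  have hn : n ≠ 0 := Nat.cast_ne_zero.2 Fintype.card_ne_zero
  -- `W g` projects the contraction `v g` onto the spectral subspace `A_g u_g`. An average of
  -- automorphisms with unimodular weights stays contractive, and it moves `v g` only by a null net,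
  -- as `v g` is asymptotically an eigenvector.
  let W : G → ι → α.CrossedProduct := fun g i ↦
    n⁻¹ • ∑ τ : G →* Circle, (τ g⁻¹ : ℂ) • α.dualAut τ (v g i)
  have hWv : ∀ g, W g - v g ∈ nullNets l α.CrossedProduct := fun g ↦ by
    have h1 := Submodule.smul_mem _ n⁻¹ (sum_mem (t := Finset.univ) fun (τ : G →* Circle) _ ↦
      Submodule.smul_mem _ (τ g⁻¹ : ℂ) (hve τ g))
    convert h1 using 1
    funext i
    simp only [W, smul_sub, smul_smul, circle_char_inv_mul, one_smul,
      Finset.sum_sub_distrib, Pi.sub_apply, Pi.smul_apply,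
      Finset.sum_apply, Finset.sum_const, Finset.card_univ]
    congr 1
    rw [← Nat.cast_smul_eq_nsmul ℂ, smul_smul, inv_mul_cancel₀ hn, one_smul]
  have hWn : ∀ g i, ‖W g i‖ ≤ 1 := fun g i ↦ by
    have h1 : ‖∑ τ : G →* Circle, (τ g⁻¹ : ℂ) • α.dualAut τ (v g i)‖ ≤ ‖n‖ := by
      refine (norm_sum_le_of_le (n := fun _ ↦ (1 : ℝ)) _ fun τ _ ↦ ?_).trans (by simp [n])
      rw [norm_smul, Circle.norm_coe, one_mul, StarAlgEquiv.norm_apply_eq]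
      exact hv1 g i
    rw [norm_smul, norm_inv, inv_mul_le_iff₀ (norm_pos_iff.2 hn), mul_one]
    exact h1
  have hW0 : ∀ g i k, k ≠ g → (W g i k : A) = 0 := fun g i k hk ↦ by
    simp only [W, n, average_dualAut_apply, if_neg hk]
  have hWw : ∀ g, W g - rep f g ∈ nullNets l α.CrossedProduct := fun g ↦
    nullNets_trans (hWv g) (hv g)
  have hWc : ∀ g, W g ∈ centralNets l α.CrossedProduct := fun g ↦ by
    simpa using add_mem (hWv g).1 (hvc g)
  have hs1 : star (W 1) - rep f 1 ∈ nullNets l α.CrossedProduct := by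
    have := star_mem_nullNets (hWw 1)
    rwa [star_sub, h.star_rep, inv_one] at this
  have hVw : ∀ g, W g * star (W 1) - rep f g ∈ nullNets l α.CrossedProduct := fun g ↦ by
    refine nullNets_trans
      (sub_mul_mem_nullNets (hWw g) hs1 (h.rep_central g) (star_mem (hWc 1))) ?_
    simpa using h.rep_mul g 1
  -- The factor `(W 1)⋆` is asymptotically a unit and preserves `A_g u_g`. It makes the coefficient
  -- of `V 1` exactly positive, of the form `aa⋆`.
  refine ⟨fun g ↦ W g * star (W 1), ⟨fun g ↦ mul_mem (hWc g) (star_mem (hWc 1)), fun g i ↦ ?_,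
    fun g i k hk ↦ ?_, fun g k ↦ ?_, h.rep_unit.congr (hVw 1)⟩, fun i ↦ ?_⟩
  · refine (norm_mul_le _ _).trans ?_
    rw [Pi.star_apply, norm_star]
    exact mul_le_one₀ (hWn g i) (norm_nonneg _) (hWn 1 i)
  · rw [Pi.mul_apply, CrossedProduct.mul_apply]
    refine Finset.sum_eq_zero fun m _ ↦ ?_
    by_cases e : m = g
    · subst e
      rw [Pi.star_apply, CrossedProduct.star_apply, hW0 1 i, star_zero, act_zero, conv_zero_right]
      exact fun e ↦ hk (inv_mul_eq_one.1 (inv_eq_one.1 e)).symm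
    · rw [hW0 g i m e, conv_zero_left]
  · refine nullNets_trans (sub_mul_mem_nullNets (hVw g) (hVw k) (h.rep_central g)
      (mul_mem (hWc k) (star_mem (hWc 1)))) ?_
    exact nullNets_trans (h.rep_mul g k) (nullNets_symm (hVw _))
  · change IsPositiveElem ((W 1 i * star (W 1 i) : α.CrossedProduct) 1 : A)
    rw [CrossedProduct.mul_star_apply_one, Finset.sum_eq_single 1]
    · exact ⟨star (W 1 i 1 : A), by rw [star_star]⟩
    · intro k _ hk
      rw [hW0 1 i k hk, zero_mul]
    · simp

end IsDualRokhlin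

end RokhlinToDualRep

end PartialAction

/-! ### Approximate representations of global actions and their duals. -/

namespace PartialAction

variable {G A ι : Type*} [CommGroup G] [NonUnitalCStarAlgebra A]
  {α : PartialAction G A} {l : Filter ι}

/-- A net witnessing the approximate representability of a global action of an abelian group. -/
structure IsApproxRep (α : PartialAction G A) (l : Filter ι) (x : G → ι → A) : Prop where
  norm_le : ∀ g i, ‖x g i‖ ≤ 1
  pos : ∀ i, IsPositiveElem (x 1 i)
  normal : ∀ g b, Tendsto (fun i ↦ (star (x g i) * x g i - x g i * star (x g i)) * b) l (𝓝 0)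
  mul : ∀ g h b, Tendsto (fun i ↦ (x g i * x h i - x 1 i * x (g * h) i) * b) l (𝓝 0)
  equivariant : ∀ g h b, Tendsto (fun i ↦ (α.act g (x h i) - x h i) * b) l (𝓝 0)
  unit : IsUnitNet l (x 1)
  conj : ∀ g b, Tendsto (fun i ↦ x g i * b - α.act g b * x g i) l (𝓝 0)

lemma IsApproxRepresentable.exists_net (h : α.IsApproxRepresentable) (hα : α.IsGlobal) :
    ∃ x : G → Finset A × ℕ → A, α.IsApproxRep atTop x := by
  classical
  choose x hx hpos hn hm he hu hc using fun p : Finset A × ℕ ↦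
    h (1 / ((p.2 : ℝ) + 1)) (by positivity) p.1
  have hconj : ∀ g b, Tendsto (fun p ↦ x p 0 g * b - α.act g b * x p 0 g) atTop (𝓝 0) :=
    fun g b ↦ tendsto_zero_of_finset {b} fun p hp ↦ hc p 0 g b (hp (by simp)) (hα.mem _ _)
  refine ⟨fun g p ↦ x p 0 g, fun g p ↦ (hx p 0 g).2, fun p ↦ hpos p 0,
    fun g b ↦ tendsto_zero_of_finset {b} fun p hp ↦ hn p 0 g b (hp (by simp)),
    fun g h b ↦ tendsto_zero_of_finset {b} fun p hp ↦ hm p 0 g h b (hp (by simp)),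
    fun g h b ↦ ?_, fun b ↦ ?_, hconj⟩
  · have hbd : ∀ p, ‖star (α.act g (x p 0 h) - x p 0 h)‖ ≤ 2 := fun p ↦ by
      rw [norm_star]
      refine (norm_sub_le _ _).trans ?_
      rw [hα.norm_act]
      linarith [(hx p 0 h).2]
    -- Let `D = α_g(x_h) - x_h`. The definition controls `D` only with an element of `A` on each
    -- side. The conjugation relation and its image under `α_g` give `Db - α_h(b)D → 0`, as `G` is
    -- abelian. Together `D b b⋆ → 0`, hence `Db → 0`.
    have h1 : Tendsto (fun p ↦ α.act h b * (α.act g (x p 0 h) - x p 0 h) * star b)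
        atTop (𝓝 0) := by
      refine tendsto_zero_of_finset {α.act g⁻¹ (α.act h b), star b} fun p hp ↦ ?_
      have := he p 0 g h (α.act g⁻¹ (α.act h b)) (hp (by simp)) (hα.mem _ _) (star b)
        (hp (by simp))
      rwa [hα.act_mul, hα.act_act_inv, mul_right_comm, mul_inv_cancel, one_mul, ← mul_sub] at this
    have h2 : Tendsto (fun p ↦ (α.act g (x p 0 h) - x p 0 h) * b -
        α.act h b * (α.act g (x p 0 h) - x p 0 h)) atTop (𝓝 0) := by
      have h3 := (hα.tendsto_act g (hconj h (α.act g⁻¹ b))).sub (hconj h b)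
      rw [sub_zero] at h3
      refine h3.congr fun p ↦ ?_
      rw [hα.act_sub, hα.act_mul, hα.act_mul, hα.act_act_inv, hα.act_act h, hα.act_act g,
        mul_comm h g⁻¹, mul_inv_cancel_left]
      noncomm_ring
    have h4 := ((h2.mul_const (star b)).add (h1.congr fun p ↦ rfl))
    rw [zero_mul, add_zero] at h4
    refine tendsto_zero_of_mul_star ((tendsto_zero_mul_of_bounded h4 hbd).congr fun p ↦ ?_)
    rw [star_mul]
    noncomm_ring
  · rw [tendsto_iff_norm_sub_tendsto_zero, ← tendsto_zero_iff_norm_tendsto_zero]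
    refine tendsto_zero_of_finset {b} fun p hp ↦ ?_
    simpa using hu p b (hp (by simp))

namespace IsApproxRep

variable {x : G → ι → A}

lemma tendsto_conj_star (h : α.IsApproxRep l x) (hα : α.IsGlobal) (g : G) (b : A) :
    Tendsto (fun i ↦ star (x g i) * α.act g b - b * star (x g i)) l (𝓝 0) := by
  refine tendsto_zero_of_star ((h.conj g (star b)).neg.congr' ?_ |>.trans (by simp))
  refine .of_forall fun i ↦ ?_
  simp [hα.act_star]

variable [Fintype G]

lemma isApproxRepresentable [l.NeBot] (h : α.IsApproxRep l x) (hα : α.IsGlobal) :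
    α.IsApproxRepresentable := by
  intro ε hε F
  have key : ∀ {u : ι → A}, Tendsto u l (𝓝 0) → ∀ᶠ i in l, ‖u i‖ < ε := fun hu ↦ by
    have := hu.norm
    rw [norm_zero] at this
    exact this.eventually_lt_const hε
  have h1 : ∀ᶠ i in l, ∀ g, ∀ b ∈ F,
      ‖(star (x g i) * x g i - x g i * star (x g i)) * b‖ < ε := by
    simp only [eventually_all, eventually_all_finset]
    exact fun g b _ ↦ key (h.normal g b)
  have h2 : ∀ᶠ i in l, ∀ g k, ∀ b ∈ F, ‖(x g i * x k i - x 1 i * x (g * k) i) * b‖ < ε := by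
    simp only [eventually_all, eventually_all_finset]
    exact fun g k b _ ↦ key (h.mul g k b)
  have h3 : ∀ᶠ i in l, ∀ g k, ∀ a ∈ F, ∀ b ∈ F,
      ‖(α.act g (a * x k i) - α.act g a * x k i) * b‖ < ε := by
    simp only [eventually_all, eventually_all_finset]
    refine fun g k a _ b _ ↦ key ?_
    have := (h.equivariant g k b).const_mul (α.act g a)
    rw [mul_zero] at this
    refine this.congr fun i ↦ ?_
    rw [hα.act_mul]
    noncomm_ring
  have h4 : ∀ᶠ i in l, ∀ b ∈ F, ‖x 1 i * b - b‖ < ε := by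
    simp only [eventually_all_finset]
    exact fun b _ ↦ key (by simpa using (h.unit b).sub_const b)
  have h5 : ∀ᶠ i in l, ∀ g, ∀ b ∈ F, ‖x g i * b - α.act g b * x g i‖ < ε := by
    simp only [eventually_all, eventually_all_finset]
    exact fun g b _ ↦ key (h.conj g b)
  obtain ⟨i, h1, h2, h3, h4, h5⟩ := (h1.and (h2.and (h3.and (h4.and h5)))).exists
  refine ⟨fun _ g ↦ x g i, fun _ g ↦ ⟨hα.mem _ _, h.norm_le g i⟩, fun _ ↦ h.pos i, fun _ ↦ h1,
    fun _ ↦ h2, fun _ g k a ha _ b hb ↦ ?_, fun b hb ↦ by simpa using h4 b hb,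
    fun _ g b hb _ ↦ h5 g b hb⟩
  rw [mul_right_comm g, mul_inv_cancel, one_mul]
  exact h3 g k a ha b hb

lemma isDualRep (h : α.IsApproxRep l x) (hα : α.IsGlobal) :
    α.IsDualRep l fun g i ↦ hα.mono g (star (x g i)) := by
  have hcen : ∀ g, (fun i ↦ hα.mono g (star (x g i))) ∈ centralNets l α.CrossedProduct := by
    refine fun g ↦ ⟨⟨1, fun i ↦ ?_⟩, fun b ↦ ?_⟩
    · rw [hα.norm_mono, norm_star]; exact h.norm_le g i
    · have h1 : ∀ k, Tendsto (fun i ↦ hα.mono g (star (x g i)) * hα.mono k (b k) -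
          hα.mono k (b k) * hα.mono g (star (x g i))) l (𝓝 0) := fun k ↦ by
        have h2 : Tendsto (fun i ↦ (b k : A) * (star (x g i) - α.act k (star (x g i)))) l
            (𝓝 0) := by
          refine tendsto_zero_of_star ((h.equivariant k g (star (b k : A))).neg.congr' ?_ |>.trans
            (by simp))
          refine .of_forall fun i ↦ ?_
          simp [hα.act_star, sub_mul]
        -- The commutator with `b_k u_k` has coefficient `(x_g⋆ α_g(b_k) - b_k x_g⋆) + b_k(x_g⋆ -
        -- α_k(x_g⋆))`.
        have h3 := (h.tendsto_conj_star hα g (b k)).add h2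
        rw [add_zero, ← hα.tendsto_mono_iff (g * k)] at h3
        refine h3.congr fun i ↦ ?_
        rw [hα.mono_mul_mono, hα.mono_mul_mono, mul_comm k g, ← hα.mono_sub]
        congr 1
        noncomm_ring
      have h4 := tendsto_finsetSum Finset.univ fun k _ ↦ h1 k
      simpa [← Finset.mul_sum, ← Finset.sum_mul, hα.sum_mono] using h4
  refine ⟨hcen, fun g i ↦ ?_, fun g i k hk ↦ hα.mono_apply_ne hk _, fun g k ↦ ?_, fun b ↦ ?_⟩
  · rw [hα.norm_mono, norm_star]; exact h.norm_le g i
  · refine mem_nullNets_of_tendsto' (sub_mem (mul_mem (hcen g) (hcen k)) (hcen _)) fun b ↦ ?_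
    have hm : ∀ a : A, Tendsto (fun i ↦ a * (star (x g i) * α.act g (star (x k i)) -
        star (x (g * k) i))) l (𝓝 0) := fun a ↦ by
      refine tendsto_zero_of_star ?_
      have hx : ∀ m i, ‖x m i‖ ≤ 1 := h.norm_le
      -- With `s = a⋆` and `d = α_{gk}(s)`, the terms telescope along `α_g(x_k)x_g s`,
      -- `α_g(x_k)α_g(s)x_g`, `x_k α_g(s)x_g`, `x_k x_g s`, `x_1 x_{gk} s`, `x_1 d x_{gk}`, `d
      -- x_{gk}`, `x_{gk} s`. Moving `s` to the left brings a fixed element next to the factor to be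
      -- replaced.
      have e1 := tendsto_mul_zero_of_bounded (C := 1) (x := fun i ↦ α.act g (x k i))
        (fun i ↦ by rw [hα.norm_act]; exact hx k i) (h.conj g (star a))
      have e2 := tendsto_zero_mul_of_bounded (h.equivariant g k (α.act g (star a))) (hx g)
      have e3 := tendsto_mul_zero_of_bounded (hx k) (h.conj g (star a))
      have e4 := h.mul k g (star a)
      have e5 := tendsto_mul_zero_of_bounded (hx 1) (h.conj (g * k) (star a))
      have e6 := tendsto_zero_mul_of_bounded (x := fun i ↦ x 1 i * α.act (g * k) (star a) -
        α.act (g * k) (star a))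
        (by simpa using (h.unit (α.act (g * k) (star a))).sub_const (α.act (g * k) (star a)))
        (hx (g * k))
      have e7 := h.conj (g * k) (star a)
      have := (((((e1.add e2).sub e3).add e4).add e5).add e6).sub e7
      simp only [add_zero, sub_zero] at this
      refine this.congr fun i ↦ ?_
      have hk : x (k * g) i = x (g * k) i := by rw [mul_comm]
      simp only [star_mul, star_sub, star_star, hα.act_star, hk]
      noncomm_ring
    have h1 : ∀ m, Tendsto (fun i ↦ hα.mono m (b m) * (hα.mono g (star (x g i)) *
        hα.mono k (star (x k i)) - hα.mono (g * k) (star (x (g * k) i)))) l (𝓝 0) := fun m ↦ by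
      have h2 := hα.tendsto_act m (hm (α.act m⁻¹ (b m)))
      rw [← hα.tendsto_mono_iff (m * (g * k))] at h2
      refine h2.congr fun i ↦ ?_
      rw [hα.mono_mul_mono, ← hα.mono_sub, hα.mono_mul_mono, hα.act_mul, hα.act_act_inv]
    have h4 := tendsto_finsetSum Finset.univ fun k _ ↦ h1 k
    simpa [← Finset.sum_mul, hα.sum_mono] using h4
  · have h1 : ∀ k, Tendsto (fun i ↦ hα.mono 1 (star (x 1 i)) * hα.mono k (b k) -
        hα.mono k (b k)) l (𝓝 0) := fun k ↦ by
      have h2 : Tendsto (fun i ↦ x 1 i * (b k : A) - b k) l (𝓝 0) := by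
        simpa using (h.unit (b k : A)).sub_const (b k : A)
      rw [← hα.tendsto_mono_iff k] at h2
      refine h2.congr fun i ↦ ?_
      rw [hα.mono_mul_mono, one_mul, act_one, (h.pos i).star_eq, hα.mono_sub]
    have h4 := tendsto_finsetSum Finset.univ fun k _ ↦ h1 k
    have h5 : Tendsto (fun i ↦ hα.mono 1 (star (x 1 i)) * b - b) l (𝓝 0) := by
      simpa [← Finset.mul_sum, Finset.sum_sub_distrib, hα.sum_mono] using h4
    simpa using h5.add_const b

end IsApproxRep

namespace IsDualRep

variable [Fintype G] {V : G → ι → α.CrossedProduct}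

lemma isApproxRep (hV : α.IsDualRep l V) (hα : α.IsGlobal)
    (hpos : ∀ i, IsPositiveElem (V 1 i 1 : A)) :
    α.IsApproxRep l fun g i ↦ star (V g i g : A) := by
  let y : G → ι → A := fun g i ↦ V g i g
  have hVy : ∀ g i, V g i = hα.mono g (y g i) := fun g i ↦
    (hα.mono_coeff (hV.apply_ne g i)).symm
  have hy : ∀ g i, ‖y g i‖ ≤ 1 := fun g i ↦
    (CrossedProduct.norm_coeff_le _ _).trans (hV.norm_le g i)
  -- Centrality of `V g`, tested on `a u_k`. The case `k = 1` is the conjugation relation up to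
  -- adjoints; its difference with general `k` is invariance under `α_k`.
  have hcomm : ∀ g k a, Tendsto (fun i ↦ y g i * α.act g a - a * α.act k (y g i)) l (𝓝 0) :=
    fun g k a ↦ by
      have h1 := centralNets_comm (hV.central g) (hα.mono k a)
      rw [← hα.tendsto_mono_iff (g * k)]
      refine h1.congr fun i ↦ ?_
      rw [hVy, hα.mono_mul_mono, hα.mono_mul_mono, mul_comm k g, ← hα.mono_sub]
  have hcomm1 : ∀ g a, Tendsto (fun i ↦ y g i * α.act g a - a * y g i) l (𝓝 0) := fun g a ↦ by
    simpa [act_one] using hcomm g 1 a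
  have hequiv : ∀ g k a, Tendsto (fun i ↦ a * (α.act k (y g i) - y g i)) l (𝓝 0) :=
    fun g k a ↦ by
      have := (hcomm1 g a).sub (hcomm g k a)
      rw [sub_zero] at this
      exact this.congr fun i ↦ by noncomm_ring
  have hmul : ∀ g k a, Tendsto (fun i ↦ a * (y g i * α.act g (y k i) - y (g * k) i)) l (𝓝 0) :=
    fun g k a ↦ by
      have h1 := nullNets_tendsto' (hV.mul g k) (hα.mono 1 a)
      rw [← hα.tendsto_mono_iff (g * k)]
      refine h1.congr fun i ↦ ?_
      rw [Pi.sub_apply, Pi.mul_apply, hVy, hVy, hVy, hα.mono_mul_mono, ← hα.mono_sub,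
        hα.mono_mul_mono, one_mul, act_one]
  have hs1 : ∀ i, star (y 1 i) = y 1 i := fun i ↦ (hpos i).star_eq
  have hunit : IsUnitNet l (y 1) := fun a ↦ by
    have h1 := (hV.unit (hα.mono 1 a)).sub_const (hα.mono 1 a)
    rw [sub_self] at h1
    have h2 : Tendsto (fun i ↦ y 1 i * a - a) l (𝓝 0) := by
      rw [← hα.tendsto_mono_iff 1]
      refine h1.congr fun i ↦ ?_
      rw [hVy, hα.mono_mul_mono, one_mul, act_one, hα.mono_sub]
    simpa using h2.add_const a
  have hVs : ∀ g, IsUnitNet l (V g * star (V g)) ∧ IsUnitNet l (star (V g) * V g) := fun g ↦ by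
    have h0 : ∀ x : ι → α.CrossedProduct, x - x ∈ nullNets l α.CrossedProduct := fun x ↦ by simp
    exact ⟨(hV.unit_mul (mul_inv_cancel g)).congr
        (sub_mul_mem_nullNets (h0 _) (hV.star_sub g) (hV.central g) (star_mem (hV.central g))),
      (hV.unit_mul (inv_mul_cancel g)).congr
        (sub_mul_mem_nullNets (hV.star_sub g) (h0 _) (hV.central _) (hV.central g))⟩
  have hco : ∀ g a, Tendsto (fun i ↦ y g i * star (y g i) * a - a) l (𝓝 0) := fun g a ↦ by
    have h1 := ((hVs g).1 (hα.mono 1 a)).sub_const (hα.mono 1 a)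
    rw [sub_self] at h1
    rw [← hα.tendsto_mono_iff 1]
    refine h1.congr fun i ↦ ?_
    rw [Pi.mul_apply, Pi.star_apply, hVy, hα.star_mono, hα.mono_mul_mono, mul_inv_cancel,
      hα.act_act_inv, hα.mono_mul_mono, one_mul, act_one, hα.mono_sub]
  -- The coefficient of `V_g⋆ V_g` is `α_{g⁻¹}(y_g⋆ y_g)`, so the limit is computed after applying
  -- `α_{g⁻¹}`. Normality follows since `y_g y_g⋆` and `y_g⋆ y_g` are both asymptotic units.
  have his : ∀ g a, Tendsto (fun i ↦ star (y g i) * y g i * a - a) l (𝓝 0) := fun g a ↦ by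
    have h1 := ((hVs g).2 (hα.mono 1 (α.act g⁻¹ a))).sub_const (hα.mono 1 (α.act g⁻¹ a))
    rw [sub_self] at h1
    have h2 : Tendsto (fun i ↦ α.act g⁻¹ (star (y g i) * y g i * a - a)) l (𝓝 0) := by
      rw [← hα.tendsto_mono_iff 1]
      refine h1.congr fun i ↦ ?_
      rw [Pi.mul_apply, Pi.star_apply, hVy, hα.star_mono, hα.mono_mul_mono, inv_mul_cancel,
        ← hα.act_mul, hα.mono_mul_mono, one_mul, act_one, ← hα.act_mul, ← hα.mono_sub,
        ← hα.act_sub]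
    simpa [hα.act_act_inv] using hα.tendsto_act g h2
  refine ⟨fun g i ↦ by rw [norm_star]; exact hy g i, fun i ↦ ?_, fun g b ↦ ?_, fun g k b ↦ ?_,
    fun g k b ↦ ?_, fun b ↦ ?_, fun g b ↦ ?_⟩
  · change IsPositiveElem (star (y 1 i))
    rw [hs1]; exact hpos i
  · have := (hco g b).sub (his g b)
    rw [sub_zero] at this
    refine this.congr fun i ↦ ?_
    rw [star_star]
    noncomm_ring
  · refine tendsto_zero_of_star ?_
    -- The first three terms sum to `b⋆(y_k y_g - y_{gk})` and the last three to `b⋆(y_{gk} - y_{gk}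
    -- y_1)`.
    have e1 := hmul k g (star b)
    have e2 := tendsto_zero_mul_of_bounded (C := 2) (hcomm1 k (star b))
      (y := fun i ↦ α.act k (y g i) - y g i) fun i ↦ by
        refine (norm_sub_le _ _).trans ?_
        rw [hα.norm_act]
        linarith [hy g i]
    have e3 := tendsto_mul_zero_of_bounded (hy k) (hequiv g k (α.act k (star b)))
    have e4 := tendsto_zero_mul_of_bounded (hcomm1 (g * k) (star b)) (hy 1)
    have e5 : Tendsto (fun i ↦ α.act (g * k) (star b) * y 1 i - α.act (g * k) (star b)) l
        (𝓝 0) := by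
      have := (hunit (star (α.act (g * k) (star b)))).sub_const (star (α.act (g * k) (star b)))
      rw [sub_self] at this
      simpa [hs1] using this.star
    have e6 := tendsto_mul_zero_of_bounded (hy (g * k)) e5
    have e7 := hcomm1 (g * k) (star b)
    have := (((((e1.add e2).sub e3).add e4).sub e6).sub e7)
    simp only [add_zero, sub_zero] at this
    refine this.congr fun i ↦ ?_
    have hk : y (k * g) i = y (g * k) i := by rw [mul_comm]
    change _ = star ((star (y g i) * star (y k i) - star (y 1 i) * star (y (g * k) i)) * b)
    have hstar : ∀ a c d e : A, star ((star a * star c - star d * star e) * b) =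
        star b * (c * a - e * d) := fun a c d e ↦ by simp
    rw [hstar, hk]
    noncomm_ring
  · refine tendsto_zero_of_star ((hequiv k g (star b)).congr fun i ↦ ?_)
    simp [hα.act_star, y]
  · refine (hunit b).congr fun i ↦ ?_
    change _ = star (y 1 i) * b
    rw [hs1]
  · refine tendsto_zero_of_star ?_
    have := (hcomm1 g (star b)).neg
    rw [neg_zero] at this
    refine this.congr fun i ↦ ?_
    simp [hα.act_star, y]

/-- The `p_χ` are the spectral projections of the representation `V`, up to null nets. Passing to
`p_χ⋆ p_χ` makes positivity exact; equivariance is exact because `V_g` lies exactly in `A_g u_g`. -/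
lemma exists_isDualRokhlin (hV : α.IsDualRep l V) :
    ∃ f : (G →* Circle) → ι → α.CrossedProduct, α.IsDualRokhlin l f ∧
      (∀ χ i, IsPositiveElem (f χ i)) ∧ ∀ χ i, ‖f χ i‖ ≤ 1 := by
  classical
  let n : ℂ := Fintype.card G
  have hn : n ≠ 0 := Nat.cast_ne_zero.2 Fintype.card_ne_zero
  let p : (G →* Circle) → ι → α.CrossedProduct := fun χ ↦ n⁻¹ • ∑ g, (χ g : ℂ) • V g
  have hpc : ∀ χ, p χ ∈ centralNets l α.CrossedProduct := fun χ ↦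
    SMulMemClass.smul_mem _ (sum_mem fun g _ ↦ SMulMemClass.smul_mem _ (hV.central g))
  have hps : ∀ χ, star (p χ) - p χ ∈ nullNets l α.CrossedProduct := fun χ ↦ by
    have h1 : n⁻¹ • ∑ g, (χ g⁻¹ : ℂ) • (star (V g) - V g⁻¹) ∈ nullNets l α.CrossedProduct :=
      Submodule.smul_mem _ _ (sum_mem fun g _ ↦ Submodule.smul_mem _ _ (hV.star_sub g))
    convert h1 using 1
    simp only [p, smul_sub, Finset.sum_sub_distrib, star_smul, star_sum]
    congr 1
    · congr 1
      · simp [n]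
      · refine Finset.sum_congr rfl fun g _ ↦ ?_
        rw [map_inv, Circle.coe_inv_eq_conj]
        rfl
    · rw [← Equiv.sum_comp (Equiv.inv G)]
      rfl
  have hpm : ∀ χ τ, p χ * p τ - (if χ = τ then p χ else 0) ∈ nullNets l α.CrossedProduct :=
    fun χ τ ↦ by
      have h1 : (n⁻¹ * n⁻¹) • ∑ g, ∑ k, ((χ g : ℂ) * (τ k : ℂ)) • (V g * V k - V (g * k)) ∈
          nullNets l α.CrossedProduct :=
        Submodule.smul_mem _ _ (sum_mem fun g _ ↦ sum_mem fun k _ ↦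
          Submodule.smul_mem _ _ (hV.mul g k))
      convert h1 using 1
      simp only [smul_sub, Finset.sum_sub_distrib]
      congr 1
      · simp only [p, smul_mul_smul_comm, Finset.sum_mul_sum]
      -- Substituting `gk` for `k` splits off the sum of `χτ⁻¹` over `G`, which vanishes unless `χ =
      -- τ`.
      · have h2 : ∀ g, ∑ k, ((χ g : ℂ) * (τ k : ℂ)) • V (g * k) =
            ∑ k, (((χ * τ⁻¹) g : Circle) : ℂ) • (τ k : ℂ) • V k := fun g ↦ by
          rw [← Equiv.sum_comp (Equiv.mulLeft g) (fun k ↦ _ • (τ k : ℂ) • V k)]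
          refine Finset.sum_congr rfl fun k _ ↦ ?_
          rw [smul_smul, Equiv.coe_mulLeft, MonoidHom.mul_apply, MonoidHom.inv_apply, ← map_inv,
            map_mul τ g k, Circle.coe_mul, Circle.coe_mul, mul_assoc, ← mul_assoc (τ g⁻¹ : ℂ),
            circle_char_inv_mul, one_mul]
        simp only [h2, ← Finset.smul_sum]
        rw [← Finset.sum_smul, sum_circle_char]
        by_cases e : χ = τ
        · subst e
          rw [if_pos rfl, if_pos (mul_inv_cancel χ), smul_smul, mul_assoc, inv_mul_cancel₀ hn,
            mul_one]
        · rw [if_neg e, if_neg (fun h ↦ e (mul_inv_eq_one.1 h)), zero_smul, smul_zero]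
  have hpn : ∀ χ i, ‖p χ i‖ ≤ 1 := fun χ i ↦ by
    have h1 : ‖∑ g, (χ g : ℂ) • V g i‖ ≤ ‖n‖ := by
      refine (norm_sum_le_of_le (n := fun _ ↦ (1 : ℝ)) _ fun g _ ↦ ?_).trans (by simp [n])
      rw [norm_smul, Circle.norm_coe, one_mul]
      exact hV.norm_le g i
    have h2 : p χ i = n⁻¹ • ∑ g, (χ g : ℂ) • V g i := by simp [p, Finset.sum_apply]
    rw [h2, norm_smul, norm_inv, inv_mul_le_iff₀ (norm_pos_iff.2 hn), mul_one]
    exact h1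
  have hfp : ∀ χ, star (p χ) * p χ - p χ ∈ nullNets l α.CrossedProduct := fun χ ↦ by
    refine nullNets_trans (sub_mul_mem_nullNets (hps χ) (y' := p χ) (by simp) (hpc χ) (hpc χ)) ?_
    simpa using hpm χ χ
  have hp1 : ∑ χ, p χ = V 1 := by
    simp only [p, ← Finset.smul_sum]
    rw [Finset.sum_comm]
    simp only [← Finset.sum_smul, sum_circle_char_apply, card_circle_char]
    simp only [ite_smul, zero_smul, Finset.sum_ite_eq', Finset.mem_univ, if_true]
    rw [smul_smul, inv_mul_cancel₀ hn, one_smul]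
  have hdual : ∀ χ τ i, α.dualAut χ (p τ i) = p (χ * τ) i := fun χ τ i ↦ by
    have h1 : ∀ g, α.dualAut χ (V g i) = (χ g : ℂ) • V g i := fun g ↦ by
      ext k
      rw [dualAut_apply, CrossedProduct.smul_apply]
      by_cases e : k = g
      · rw [e]
      · rw [hV.apply_ne g i k e, smul_zero, smul_zero]
    simp only [p, Pi.smul_apply, Finset.sum_apply, map_smul, map_sum, h1, smul_smul,
      MonoidHom.mul_apply, Circle.coe_mul]
    simp only [mul_comm]
  refine ⟨fun χ ↦ star (p χ) * p χ, ⟨fun χ ↦ by simp, fun χ ↦ mul_mem (star_mem (hpc χ)) (hpc χ),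
    fun χ τ hχ ↦ ?_, ?_, fun χ τ ↦ ?_⟩, fun χ i ↦ ⟨p χ i, rfl⟩, fun χ i ↦ ?_⟩
  · have h1 := sub_mul_mem_nullNets (hfp χ) (hfp τ) (hpc χ) (mul_mem (star_mem (hpc τ)) (hpc τ))
    have h2 := hpm χ τ
    rw [if_neg hχ, sub_zero] at h2
    simpa using add_mem h1 h2
  · refine hV.unit.congr ?_
    rw [← hp1, ← Finset.sum_sub_distrib]
    exact sum_mem fun χ _ ↦ hfp χ
  · convert zero_mem (nullNets l α.CrossedProduct) using 1
    funext i
    simp [map_mul, map_star, hdual]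
  · change ‖star (p χ i) * p χ i‖ ≤ 1
    rw [CStarRing.norm_star_mul_self]
    exact mul_le_one₀ (hpn χ i) (norm_nonneg _) (hpn χ i)

end IsDualRep

end PartialAction

theorem mainTheorem3 {G A : Type*} [CommGroup G] [Fintype G] [NonUnitalCStarAlgebra A]
    [TopologicalSpace.SeparableSpace A] (α : PartialAction G A) :
    α.dual.HasRokhlinProperty ↔ (α.IsGlobal ∧ α.IsApproxRepresentable) := by
  classical
  constructor
  · intro h
    obtain ⟨f, hf⟩ := h.exists_net
    obtain ⟨V, hV, hpos⟩ := hf.exists_isDualRep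
    have hα := hV.isGlobal
    exact ⟨hα, (hV.isApproxRep hα hpos).isApproxRepresentable hα⟩
  · rintro ⟨hα, h⟩
    obtain ⟨x, hx⟩ := h.exists_net hα
    obtain ⟨f, hf, hpos, hnorm⟩ := (hx.isDualRep hα).exists_isDualRokhlin
    exact PartialAction.hasRokhlinProperty_of_net hf hpos hnorm
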